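/- **Setting.** Let $\Bbbk$ be a field and $m\ge 0$. Let $Q$ be the quiver with vertices $e_0,\dots,e_m$ and arrows $p_i\colon e_{i-1}\to e_i$ and $q_{i-1}\colon e_i\to e_{i-1}$ ($1\le i\le m$), $s_i\colon e_i\to e_i$ ($0\le i\le m$); paths are composed from right to left. Consider the reduction system $$q_ip_{i+1}\mapsto s_i,\qquad p_iq_{i-1}\mapsto s_i,\qquad s_ip_i\mapsto p_is_{i-1},\qquad s_iq_i\mapsto q_is_{i+1},$$ let $S$ be its set of left-hand sides $t$, with $t\mapsto\varphi_t$, and let $A=\Bbbk Q/I$ with $I=\langle t-\varphi_t\mid t\in S\rangle$ and $\pi\colon\Bbbk Q\to A$ the projection. Write $w\preceq w'$ if the path $w'$ can be turned into $w$ by finitely many (possibly no) replacements of a subpath $t\in S$ by $\varphi_t$. Every path reduces to exactly one irreducible path (one without subpath in $S$), and the irreducible paths form a basis of $A$, by which $A$ is regarded as a subspace of $\Bbbk Q$. All tensor products are over $\Bbbk Q_0$. Let $S_n$ be the set of paths of length $n$ all of whose subpaths of length two lie in $S$ (so $S_0=Q_0$, $S_1=Q_1$, $S_2=S$), let $P_n=A\otimes\Bbbk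 S_n\otimes A$ for $n\ge0$ and $P_{-1}=A$, and $$\mathrm{split}_n(w)=\sum_{w=urv,\ r\in S_n}\pi(u)\otimes r\otimes\pi(v)\in P_n .$$ *Chouhy–Solotar resolution.* Let $\delta_0(x\otimes y)=\pi(xy)$ and, for $n\ge1$, $\delta_n(x\otimes w\otimes y)=x\cdot\mathrm{split}_{n-1}(w)\cdot y$ for $n$ even and $x\cdot(\mathrm{split}^{L}_{n-1}(w)-\mathrm{split}^{R}_{n-1}(w))\cdot y$ for $n$ odd, where $\mathrm{split}^{L}_{n-1}(w)$, $\mathrm{split}^{R}_{n-1}(w)$ are the summands of $\mathrm{split}_{n-1}(w)$ for the leftmost and the rightmost subpath of $w$ in $S_{n-1}$. Let $\gamma_{-1}(x)=1\otimes x$, $\gamma_{n-1}(x\otimes w\otimes y)=(-1)^n\,\mathrm{split}_n(xw)\cdot y$ for $n\ge 1$ and irreducible $x$. Define recursively $\partial_0=\delta_0$, $\rho_{-1}=\gamma_{-1}$, and for $n\ge1$ $$\partial_n(x\otimes w\otimes y)=x\cdot\big((\mathrm{id}-\rho_{n-2}\partial_{n-1})\delta_n\big)(1\otimes w\otimes1)\cdot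 y,\qquad \rho_{n-1}=\gamma_{n-1}+\sum_{i\ge1}\gamma_{n-1}(\delta_n\gamma_{n-1}-\partial_n\gamma_{n-1})^i .$$ *Comparison map.* Let $\mathrm{Bar}_n=A\otimes\bar A^{\otimes n}\otimes A$, $\bar A=A/\Bbbk Q_0$, be the normalized bar resolution, with $\bar\partial_0$ the multiplication and, for $n\ge 1$, $$\bar\partial_n(a_{n+1}\otimes[a_n|\cdots|a_1]\otimes a_0)=a_{n+1}\otimes[a_n|\cdots|a_2]\otimes a_1a_0+\sum_{i=1}^{n-1}(-1)^ia_{n+1}\otimes[a_n|\cdots|a_{i+1}a_i|\cdots|a_1]\otimes a_0+(-1)^na_{n+1}a_n\otimes[a_{n-1}|\cdots|a_1]\otimes a_0 .$$ The comparison map $G_n\colon\mathrm{Bar}_n\to P_n$ of the Barmeier–Wang homotopy deformation retract is given by $G_{-1}=\mathrm{id}_A$ and $G_n(a\otimes y\otimes b)=a\cdot\rho_{n-1}G_{n-1}\bar\partial_n(1\otimes y\otimes b)$. **Theorem.** For all $n\ge0$ the sum defining $\rho_n$ is finite on every basis element of $P_n$. Let $n\ge0$, let $y_n,\dots,y_1$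 be irreducible paths of positive length whose concatenation $y_n\cdots y_1$ is a path (for $n=0$: a vertex $e_i$), and let $T(y_n\cdots y_1)$ be the set of all pure tensors $\pi(u)\otimes r\otimes\pi(v)$ which occur as a summand of $\mathrm{split}_n(w)$ for some $w\preceq y_n\cdots y_1$. Then $T(y_n\cdots y_1)$ is finite and, for all $a,b\in A$, $$G_n(a\otimes[y_n|\cdots|y_1]\otimes b)=a\cdot\Big(\sum_{\tau\in T(y_n\cdots y_1)}\tau\Big)\cdot b ,$$ that is, $G_n(a\otimes[y_n|\cdots|y_1]\otimes b)=a\cdot\sum_{w\preceq y_n\cdots y_1}\mathrm{split}_n(w)\cdot b$, where every pure tensor arising from different $w$ is counted only once (for $n=0$ the left-hand side is $G_0(ae_i\otimes e_ib)$). For $n\ge2$ the set $T(y_n\cdots y_1)$ is described as follows. Say that a path crosses the red strand $x_{j+1}$ ($0\le j<m$) if one of its endpoints is among $e_0,\dots,e_j$ and the other among $e_{j+1},\dots,e_m$. For each strand $x_{j+1}$ crossed by all of $y_{n-1},\dots,y_1$, let $c\in\{p_{j+1},q_j\}$ be the arrow at which $y_{n-1}=y'cy''$ crosses it, let $\bar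 c$ be the other arrow of $\{p_{j+1},q_j\}$, and let $\pi(y_ny')=a\,s^M$ with $a$ a path without loops $s$. The elements of $T(y_n\cdots y_1)$ are * for each $0\le d<M$ ($d$ of the $M$ top dots have been dropped): $\;a\,s^{M-d-1}\otimes (s\,c\,\bar c\,c\cdots)\otimes v$, where $c\,\bar c\,c\cdots$ has length $n-1$; * if $y_n$ crosses the strand too, at $y_n=a'\bar c z$ (all top dots have been dropped): $\;a'\otimes(\bar c\,c\,\bar c\cdots)\otimes v$, where $\bar c\,c\,\bar c\cdots$ has length $n$; where in each case $v$ is the unique irreducible path with the source of $y_1$ such that the tensor $u\otimes r\otimes v$ is composable and $\pi(urv)=\pi(y_n\cdots y_1)$. -/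

import Mathlib

namespace KLRW

open Relation

/-! ### The quiver, its paths and its reduction system

For `m` red strands (punctures) the quiver `Q` has the vertices `e_0, …, e_m`.  At the vertex `e_a`
start at most three arrows: `p` (that is `p_{a+1} : e_a → e_{a+1}`), `q`
(that is `q_{a-1} : e_a → e_{a-1}`) and the loop `s` (that is `s_a`).  Hence a path is determined by
its source and by its word in the letters `p`, `q`, `s`.  Words are written as in
`u_{k-1} ⋯ u_1 u_0`: the rightmost letter is traversed first. -/

inductive Arrow
  | p
  | q
  | s
  deriving DecidableEq

open Arrow

/-- Words in the letters `p`, `q`, `s`. -/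
abbrev Word := List Arrow

/-- A word starting at `e_a` ends at `e_{a + shift w}`. -/
def shift (w : Word) : ℤ := (w.count p : ℤ) - (w.count q : ℤ)

/-- `w`, read from right to left starting at `e_a`, is a path of the quiver with the vertices
`e_0, …, e_m`: all vertices it visits exist. -/
def IsPath (m : ℕ) (a : ℤ) (w : Word) : Prop :=
  ∀ t : Word, t <:+ w → 0 ≤ a + shift t ∧ a + shift t ≤ m

/-- The reduction system `R`, as pairs `(s, φ_s)`:
`q_i p_{i+1} ↦ s_i`, `p_i q_{i-1} ↦ s_i`, `s_i p_i ↦ p_i s_{i-1}`, `s_i q_i ↦ q_i s_{i+1}`. -/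
inductive Rule : Word → Word → Prop
  | qp : Rule [q, p] [s]
  | pq : Rule [p, q] [s]
  | sp : Rule [s, p] [p, s]
  | sq : Rule [s, q] [q, s]

/-- The set `S` of left-hand sides of the reduction system. -/
def InS (w : Word) : Prop := ∃ f, Rule w f

/-- A path is irreducible if it contains no element of `S` as a subpath. -/
def Irr (w : Word) : Prop := ∀ t, InS t → ¬ t <:+: w

/-- The set `S_n`.  `S_0` consists of the vertices, `S_1` of the arrows, `S_2 = S`, and for `n > 2`
the elements of `S_n` are the `(n-2)`-ambiguities, i.e. (as all elements of `S` have length two)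
the paths `u_{n-1} ⋯ u_1 u_0` with arrows `u_i` such that every `u_{i+1} u_i` is in `S`. -/
def Amb (n : ℕ) (w : Word) : Prop := w.length = n ∧ w.IsChain (fun x y => InS [x, y])

/-- One reduction: a subpath `t ∈ S` is replaced by `φ_t`. -/
inductive Step : Word → Word → Prop
  | mk (u t f v : Word) (h : Rule t f) : Step (u ++ t ++ v) (u ++ f ++ v)

/-- `Reduces w w'` is the relation `w' ⪯ w`.  Since every `φ_t` is a single path with coefficient
one, reductions turn a path into a path. -/
def Reduces : Word → Word → Prop := ReflTransGen Step

/-- The irreducible path to which `w` reduces, `a_{ji} s_i^α`; it represents `π(w)`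
(see `reduces_nf`, `irr_nf`, `nf_unique` and `nf_eq_iff`). -/
def nf (w : Word) : Word :=
  List.replicate (w.count p - w.count q) p ++ List.replicate (w.count q - w.count p) q ++
    List.replicate (w.count s + min (w.count p) (w.count q)) s

/-! ### Reduction uniqueness -/

theorem shift_append (u v : Word) : shift (u ++ v) = shift u + shift v := by
  simp only [shift, List.count_append]; push_cast; ring

theorem shift_nil : shift [] = 0 := by simp [shift]

theorem isPath_append (m : ℕ) (a : ℤ) (u v : Word) :
    IsPath m a (u ++ v) ↔ IsPath m a v ∧ IsPath m (a + shift v) u := by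
  constructor
  · intro h
    refine ⟨fun t ht => h t (ht.trans (List.suffix_append u v)), fun t ht => ?_⟩
    have := h (t ++ v) (by obtain ⟨z, rfl⟩ := ht; exact ⟨z, by simp⟩)
    rw [shift_append] at this
    constructor <;> linarith [this.1, this.2]
  · rintro ⟨h1, h2⟩ t ht
    rcases List.suffix_or_suffix_of_suffix ht (List.suffix_append u v) with h | h
    · exact h1 t h
    · obtain ⟨z, rfl⟩ := h
      have hz : z <:+ u := by
        obtain ⟨y, hy⟩ := ht
        rw [← List.append_assoc] at hy
        exact ⟨y, List.append_cancel_right hy⟩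
      have := h2 z hz
      rw [shift_append]
      constructor <;> linarith [this.1, this.2]

theorem isPath_cons (m : ℕ) (a : ℤ) (x : Arrow) (v : Word) :
    IsPath m a (x :: v) ↔
      IsPath m a v ∧ 0 ≤ a + shift (x :: v) ∧ a + shift (x :: v) ≤ m := by
  constructor
  · intro h
    exact ⟨fun t ht => h t (ht.trans (List.suffix_cons x v)), h _ List.suffix_rfl⟩
  · rintro ⟨h1, h2⟩ t ht
    rcases List.suffix_cons_iff.1 ht with rfl | h
    · exact h2
    · exact h1 t h

theorem isPath_nil (m : ℕ) (a : ℤ) : IsPath m a [] ↔ 0 ≤ a ∧ a ≤ m := by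
  simp [IsPath, shift]

theorem rule_shift {t f : Word} (h : Rule t f) : shift f = shift t := by
  cases h <;> decide

theorem rule_isPath {m : ℕ} {a : ℤ} {t f : Word} (h : Rule t f) (ht : IsPath m a t) :
    IsPath m a f := by
  cases h <;> simp only [isPath_cons, isPath_nil] at ht ⊢ <;>
    simp [shift] at ht ⊢ <;> omega

theorem step_isPath {m : ℕ} {a : ℤ} {w w' : Word} (h : Step w w') (hw : IsPath m a w) :
    IsPath m a w' := by
  obtain ⟨u, t, f, v, hr⟩ := h
  simp only [isPath_append, rule_shift hr] at hw ⊢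
  exact ⟨hw.1, rule_isPath hr hw.2.1, hw.2.2⟩

theorem reduces_isPath {m : ℕ} {a : ℤ} {w w' : Word} (h : Reduces w w') (hw : IsPath m a w) :
    IsPath m a w' := by
  induction h with
  | refl => exact hw
  | tail _ hs ih => exact step_isPath hs ih

theorem step_context {w w' : Word} (u v : Word) (h : Step w w') :
    Step (u ++ w ++ v) (u ++ w' ++ v) := by
  obtain ⟨u', t, f, v', hr⟩ := h
  have := Step.mk (u ++ u') t f (v' ++ v) hr
  simpa [List.append_assoc] using this

theorem reduces_context {w w' : Word} (u v : Word) (h : Reduces w w') :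
    Reduces (u ++ w ++ v) (u ++ w' ++ v) := by
  induction h with
  | refl => exact ReflTransGen.refl
  | tail _ hs ih => exact ih.tail (step_context u v hs)

theorem reduces_s_replicate (x : Arrow) (hx : Rule [s, x] [x, s]) (n : ℕ) :
    Reduces (s :: List.replicate n x) (List.replicate n x ++ [s]) := by
  induction n with
  | zero => exact ReflTransGen.refl
  | succ n ih =>
    have h1 : Step (s :: List.replicate (n + 1) x) ([x] ++ (s :: List.replicate n x) ++ []) := by
      have := Step.mk [] _ _ (List.replicate n x) hx
      simpa [List.replicate_succ] using this
    have h2 := reduces_context [x] [] ih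
    have := ReflTransGen.head h1 h2
    simpa [Reduces, List.replicate_succ] using this

/-- Every path reduces to its normal form. -/
theorem reduces_nf (w : Word) : Reduces w (nf w) := by
  induction w with
  | nil => exact ReflTransGen.refl
  | cons x w ih =>
    have h1 : Reduces (x :: w) (x :: nf w) := by
      have := reduces_context [x] [] ih
      simpa using this
    refine h1.trans ?_
    unfold nf
    rcases Nat.lt_or_ge (w.count p) (w.count q) with h | h
    · obtain ⟨b, hb⟩ : ∃ b, w.count q = w.count p + 1 + b := ⟨_, (Nat.add_sub_of_le h).symm⟩
      cases x
      · have h2 : Step ([p, q] ++ (List.replicate b q ++ List.replicate (w.count s + w.count p) s))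
            ([s] ++ (List.replicate b q ++ List.replicate (w.count s + w.count p) s)) := by
          have := Step.mk [] _ _ (List.replicate b q ++ List.replicate (w.count s + w.count p) s)
            Rule.pq
          simpa using this
        have h3 := reduces_context [] (List.replicate (w.count s + w.count p) s)
          (reduces_s_replicate q Rule.sq b)
        have h4 := ReflTransGen.head h2 (by simpa [Reduces] using h3)
        have e1 : w.count p + 1 - w.count q = 0 := by omega
        have e2 : w.count q - (w.count p + 1) = b := by omega
        have e3 : w.count q - w.count p = b + 1 := by omega
        have e4 : w.count p - w.count q = 0 := by omega
        have e5 : min (w.count p + 1) (w.count q) = w.count p + 1 := by omega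
        have e6 : min (w.count p) (w.count q) = w.count p := by omega
        have e7 : w.count s + (w.count p + 1) = (w.count s + w.count p) + 1 := by omega
        simpa [e1, e2, e3, e4, e5, e6, e7, List.replicate_succ] using h4
      · have e1 : w.count p - (w.count q + 1) = 0 := by omega
        have e2 : (w.count q + 1) - w.count p = (w.count q - w.count p) + 1 := by omega
        have e4 : w.count p - w.count q = 0 := by omega
        have e5 : min (w.count p) (w.count q + 1) = w.count p := by omega
        have e6 : min (w.count p) (w.count q) = w.count p := by omega
        simp [e1, e2, e4, e5, e6, List.replicate_succ]
        exact ReflTransGen.refl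
      · have h3 := reduces_context [] (List.replicate (w.count s + w.count p) s)
          (reduces_s_replicate q Rule.sq (w.count q - w.count p))
        have e4 : w.count p - w.count q = 0 := by omega
        have e6 : min (w.count p) (w.count q) = w.count p := by omega
        have e7 : w.count s + 1 + w.count p = (w.count s + w.count p) + 1 := by omega
        simpa [e4, e6, e7, List.replicate_succ, Reduces] using h3
    · cases x
      · have e1 : w.count q - (w.count p + 1) = 0 := by omega
        have e2 : (w.count p + 1) - w.count q = (w.count p - w.count q) + 1 := by omega
        have e4 : w.count q - w.count p = 0 := by omega
        have e5 : min (w.count p + 1) (w.count q) = w.count q := by omega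
        have e6 : min (w.count p) (w.count q) = w.count q := by omega
        simp [e1, e2, e4, e5, e6, List.replicate_succ]
        exact ReflTransGen.refl
      · rcases Nat.eq_or_lt_of_le h with h | h
        · have e1 : w.count q + 1 - w.count p = 1 := by omega
          have e2 : w.count p - (w.count q + 1) = 0 := by omega
          have e3 : w.count q - w.count p = 0 := by omega
          have e4 : w.count p - w.count q = 0 := by omega
          have e5 : min (w.count p) (w.count q + 1) = w.count q := by omega
          have e6 : min (w.count p) (w.count q) = w.count q := by omega
          simp [e1, e2, e3, e4, e5, e6]
          exact ReflTransGen.refl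
        · obtain ⟨b, hb⟩ : ∃ b, w.count p = w.count q + 1 + b := ⟨_, (Nat.add_sub_of_le h).symm⟩
          have h2 : Step
              ([q, p] ++ (List.replicate b p ++ List.replicate (w.count s + w.count q) s))
              ([s] ++ (List.replicate b p ++ List.replicate (w.count s + w.count q) s)) := by
            have := Step.mk [] _ _
              (List.replicate b p ++ List.replicate (w.count s + w.count q) s) Rule.qp
            simpa using this
          have h3 := reduces_context [] (List.replicate (w.count s + w.count q) s)
            (reduces_s_replicate p Rule.sp b)
          have h4 := ReflTransGen.head h2 (by simpa [Reduces] using h3)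
          have e1 : w.count q + 1 - w.count p = 0 := by omega
          have e2 : w.count p - (w.count q + 1) = b := by omega
          have e3 : w.count p - w.count q = b + 1 := by omega
          have e4 : w.count q - w.count p = 0 := by omega
          have e5 : min (w.count p) (w.count q + 1) = w.count q + 1 := by omega
          have e6 : min (w.count p) (w.count q) = w.count q := by omega
          have e7 : w.count s + (w.count q + 1) = (w.count s + w.count q) + 1 := by omega
          simpa [e1, e2, e3, e4, e5, e6, e7, List.replicate_succ] using h4
      · have h3 := reduces_context [] (List.replicate (w.count s + w.count q) s)
          (reduces_s_replicate p Rule.sp (w.count p - w.count q))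
        have e4 : w.count q - w.count p = 0 := by omega
        have e6 : min (w.count p) (w.count q) = w.count q := by omega
        have e7 : w.count s + 1 + w.count q = (w.count s + w.count q) + 1 := by omega
        simpa [e4, e6, e7, List.replicate_succ, Reduces] using h3

theorem irr_of_isChain {w : Word} (h : w.IsChain (fun x y => ¬ InS [x, y])) : Irr w := by
  rintro t ⟨f, hf⟩ ⟨a, b, rfl⟩
  have key : ∀ x y : Arrow, InS [x, y] → (a ++ [x, y] ++ b).IsChain (fun x y => ¬ InS [x, y]) →
      False := by
    intro x y hxy hc
    rw [List.isChain_append] at hc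
    have := (List.isChain_append.1 hc.1).2.1
    simp at this
    exact this hxy
  cases hf
  · exact key _ _ ⟨_, Rule.qp⟩ h
  · exact key _ _ ⟨_, Rule.pq⟩ h
  · exact key _ _ ⟨_, Rule.sp⟩ h
  · exact key _ _ ⟨_, Rule.sq⟩ h

/-- Normal forms are irreducible. -/
theorem irr_nf (w : Word) : Irr (nf w) := by
  have hself : ∀ x : Arrow, ¬ InS [x, x] := by
    rintro x ⟨f, hf⟩; cases x <;> cases hf
  have hps : ¬ InS [p, s] := by rintro ⟨f, hf⟩; cases hf
  have hqs : ¬ InS [q, s] := by rintro ⟨f, hf⟩; cases hf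
  have hrep : ∀ (n : ℕ) (x : Arrow),
      (List.replicate n x).IsChain (fun x y => ¬ InS [x, y]) := fun n x =>
    List.isChain_replicate_of_rel n (hself x)
  have hcat : ∀ (a d : ℕ) (x : Arrow), ¬ InS [x, s] →
      (List.replicate a x ++ List.replicate d s).IsChain (fun x y => ¬ InS [x, y]) := by
    intro a d x hx
    refine List.IsChain.append (hrep a x) (hrep d s) ?_
    intro y hy z hz
    have hy' := List.eq_of_mem_replicate (List.mem_of_mem_getLast? hy)
    have hz' := List.eq_of_mem_replicate (List.mem_of_mem_head? hz)
    subst hy' hz'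
    exact hx
  apply irr_of_isChain
  unfold nf
  rcases le_total (w.count p) (w.count q) with h | h
  · rw [Nat.sub_eq_zero_of_le h]
    simpa using hcat _ _ q hqs
  · rw [Nat.sub_eq_zero_of_le h]
    simpa using hcat _ _ p hps

theorem step_nf {w w' : Word} (h : Step w w') : nf w' = nf w := by
  obtain ⟨u, t, f, v, hr⟩ := h
  have h1 : f.count p + t.count q = t.count p + f.count q := by cases hr <;> rfl
  have h2 : f.count s + min (f.count p) (f.count q) = t.count s + min (t.count p) (t.count q) := by
    cases hr <;> rfl
  have h3 : 2 * f.count s + f.count p + f.count q = 2 * t.count s + t.count p + t.count q := by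
    cases hr <;> rfl
  simp only [nf, List.count_append]
  congr 1
  · congr 2 <;> omega
  · congr 1
    omega

theorem irr_not_step {w w' : Word} (h : Irr w) : ¬ Step w w' := by
  rintro ⟨u, t, f, v, hr⟩
  exact h t ⟨f, hr⟩ ⟨u, v, rfl⟩

/-- Reduction uniqueness: the normal form is the only irreducible path a path reduces to. -/
theorem nf_unique {w w' : Word} (h : Reduces w w') (hw : Irr w') : w' = nf w := by
  have h1 : nf w' = nf w := by
    clear hw
    induction h with
    | refl => rfl
    | tail _ ht ih => rw [step_nf ht, ih]
  rcases (ReflTransGen.cases_head (reduces_nf w')) with h2 | ⟨z, hz, _⟩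
  · exact h2.trans h1
  · exact absurd hz (irr_not_step hw)

/-- Words have the same normal form exactly if they are identified by the relations `t = φ_t`.
(Reductions preserve being a path of the quiver, see `step_isPath`, so for parallel paths this is
equality modulo the ideal generated by the `t - φ_t`.) -/
theorem nf_eq_iff (u v : Word) : nf u = nf v ↔ EqvGen Step u v := by
  constructor
  · intro h
    have key : ∀ {a b : Word}, Reduces a b → EqvGen Step a b := by
      intro a b hab
      induction hab with
      | refl => exact EqvGen.refl _
      | tail _ hs ih => exact EqvGen.trans _ _ _ ih (EqvGen.rel _ _ hs)
    have h1 := key (reduces_nf u)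
    rw [h] at h1
    exact EqvGen.trans _ _ _ h1 (EqvGen.symm _ _ (key (reduces_nf v)))
  · intro h
    induction h with
    | rel _ _ h => exact (step_nf h).symm
    | refl => rfl
    | symm _ _ _ ih => exact ih.symm
    | trans _ _ _ _ _ ih1 ih2 => exact ih1.trans ih2

theorem shift_nf (w : Word) : shift (nf w) = shift w := by
  have : ∀ a b d : ℕ, shift (List.replicate a p ++ List.replicate b q ++ List.replicate d s)
      = a - b := by
    intro a b d
    simp [shift, List.count_append, List.count_replicate]
  rw [nf, this, shift]
  omega

theorem isPath_nf {m : ℕ} {a : ℤ} {w : Word} (h : IsPath m a w) : IsPath m a (nf w) :=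
  reduces_isPath (reduces_nf w) h

theorem isPath_nf_append {m : ℕ} {a : ℤ} {u v : Word} (h : IsPath m a (u ++ v)) :
    IsPath m a (nf u ++ nf v) := by
  rw [isPath_append] at h ⊢
  rw [shift_nf]
  exact ⟨isPath_nf h.1, isPath_nf h.2⟩

theorem reduces_flatten_nf (ys : List Word) : Reduces ys.flatten (ys.map nf).flatten := by
  induction ys with
  | nil => exact ReflTransGen.refl
  | cons y ys ih =>
    have h1 := reduces_context [] ys.flatten (reduces_nf y)
    have h2 := reduces_context (nf y) [] ih
    simp only [List.flatten_cons, List.map_cons]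
    exact ReflTransGen.trans (by simpa [Reduces] using h1) (by simpa [Reduces] using h2)

/-! ### The algebra and the bimodules, by their standard bases

All tensor products are over `𝕜 Q_0`, so a pure tensor of paths vanishes unless the paths are
composable, and the composable pure tensors of basis elements form a basis. -/

/-- Irreducible paths of the quiver. -/
@[ext] structure IrrPath (m : ℕ) where
  src : ℤ
  word : Word
  irr : Irr word
  isPath : IsPath m src word

/-- The basis `u ⊗ r ⊗ v` of `P_n = A ⊗ 𝕜 S_n ⊗ A`: `u = left` and `v = right` are irreducible,
`r = mid ∈ S_n`, and `u r v` is composable; `src` is the source of `v`. -/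
@[ext] structure Gen (m n : ℕ) where
  src : ℤ
  left : Word
  mid : Word
  right : Word
  left_irr : Irr left
  mid_amb : Amb n mid
  right_irr : Irr right
  isPath : IsPath m src (left ++ mid ++ right)

/-- The basis `x ⊗ [y_n|⋯|y_1] ⊗ z` of the normalized bar module `A ⊗ Ā^{⊗ n} ⊗ A`: all of
`x`, `y_n`, …, `y_1`, `z` are irreducible, the `y_i` (listed from `y_n` to `y_1`) are not vertices,
and `x y_n ⋯ y_1 z` is composable; `src` is the source of `z`. -/
@[ext] structure BarGen (m n : ℕ) where
  src : ℤ
  left : Word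
  mid : List Word
  right : Word
  left_irr : Irr left
  mid_length : mid.length = n
  mid_irr : ∀ y ∈ mid, Irr y ∧ y ≠ []
  right_irr : Irr right
  isPath : IsPath m src (left ++ mid.flatten ++ right)

section

variable (k : Type*) [Field k] (m : ℕ)

/-- The algebra `A = 𝕜Q/I` on its basis of irreducible paths. -/
abbrev A : Type _ := IrrPath m →₀ k

/-- The bimodule `P_n`. -/
abbrev P (n : ℕ) : Type _ := Gen m n →₀ k

/-- The normalized bar module `Bar_n`. -/
abbrev Bar (n : ℕ) : Type _ := BarGen m n →₀ k

open Classical in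
/-- `π(w) ∈ A` for the path `w` starting at `e_a`. -/
noncomputable def proj (a : ℤ) (w : Word) : A k m :=
  if h : IsPath m a w then Finsupp.single ⟨a, nf w, irr_nf w, isPath_nf h⟩ 1 else 0

open Classical in
/-- `π(u) ⊗ r ⊗ π(v) ∈ P_n` for the path `u r v` starting at `e_a`. -/
noncomputable def tens (n : ℕ) (a : ℤ) (u r v : Word) : P k m n :=
  if h : Amb n r ∧ IsPath m a (u ++ r ++ v) then
    Finsupp.single ⟨a, nf u, r, nf v, irr_nf u, h.1, irr_nf v, by
      have h2 := h.2
      rw [isPath_append, isPath_append] at h2 ⊢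
      rw [shift_nf]
      exact ⟨isPath_nf h2.1, h2.2.1, isPath_nf h2.2.2⟩⟩ 1
  else 0

open Classical in
/-- `π(x) ⊗ [π(y_n)|⋯|π(y_1)] ⊗ π(z) ∈ Bar_n` for the path `x y_n ⋯ y_1 z` starting at `e_a`;
it vanishes if some `π(y_i)` is a vertex. -/
noncomputable def barTens (n : ℕ) (a : ℤ) (x : Word) (ys : List Word) (z : Word) : Bar k m n :=
  if h : ys.length = n ∧ (∀ y ∈ ys, nf y ≠ []) ∧ IsPath m a (x ++ ys.flatten ++ z) then
    Finsupp.single ⟨a, nf x, ys.map nf, nf z, irr_nf x, by simpa using h.1, by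
      intro y hy
      obtain ⟨y', hy', rfl⟩ := List.mem_map.1 hy
      exact ⟨irr_nf y', h.2.1 y' hy'⟩, irr_nf z, by
      have h2 := reduces_isPath (reduces_context x z (reduces_flatten_nf ys)) h.2.2
      have h3 := reduces_isPath (reduces_context [] ((ys.map nf).flatten ++ z) (reduces_nf x))
        (by simpa using h2)
      have h4 := reduces_isPath (reduces_context (nf x ++ (ys.map nf).flatten) [] (reduces_nf z))
        (by simpa using h3)
      simpa using h4⟩ 1
  else 0

variable {m} in
/-- The vertex at which the path `u r v` underlying a basis element ends. -/
def Gen.tgt {n : ℕ} (t : Gen m n) : ℤ := t.src + shift (t.left ++ t.mid ++ t.right)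

/-- Left multiplication on `P_n` by the path `x` starting at `e_a`. -/
noncomputable def lact (n : ℕ) (a : ℤ) (x : Word) : P k m n →ₗ[k] P k m n :=
  Finsupp.linearCombination k fun t =>
    if a = t.tgt then tens k m n t.src (x ++ t.left) t.mid t.right else 0

/-- Right multiplication on `P_n` by the path `y` starting at `e_a`. -/
noncomputable def ract (n : ℕ) (a : ℤ) (y : Word) : P k m n →ₗ[k] P k m n :=
  Finsupp.linearCombination k fun t =>
    if a + shift y = t.src then tens k m n a t.left t.mid (t.right ++ y) else 0

variable {k m} in
/-- The left action of `A` on `P_n`. -/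
noncomputable def lmul {n : ℕ} (a : A k m) (f : P k m n) : P k m n :=
  a.sum fun x c => c • lact k m n x.src x.word f

variable {k m} in
/-- The right action of `A` on `P_n`. -/
noncomputable def rmul {n : ℕ} (f : P k m n) (b : A k m) : P k m n :=
  b.sum fun y c => c • ract k m n y.src y.word f

variable {k m} in
/-- The element `a ⊗ [y_n|⋯|y_1] ⊗ b` of `Bar_n` for `a, b ∈ A` and irreducible paths `y_i` such
that `y_n ⋯ y_1` is a path starting at `e_i`.  For `n = 0` this is `a e_i ⊗ e_i b`. -/
noncomputable def bar (n : ℕ) (a : A k m) (i : ℤ) (ys : List Word) (b : A k m) : Bar k m n :=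
  a.sum fun x c => b.sum fun z d => (c * d) •
    if x.src = i + shift ys.flatten ∧ z.src + shift z.word = i then
      barTens k m n z.src x.word ys z.word else 0

/-! ### The Chouhy–Solotar resolution -/

/-- `split_n(w)` for the path `w` starting at `e_a`: the sum of `π(u) ⊗ r ⊗ π(v)` over all
decompositions `w = u r v` with `r ∈ S_n`.  (Decompositions are indexed by the length `l` of `u`;
if the subpath of length `n` at this position does not exist or is not in `S_n`, `tens` is `0`.) -/
noncomputable def split (n : ℕ) (a : ℤ) (w : Word) : P k m n :=
  ∑ l ∈ Finset.range (w.length + 1),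
    tens k m n a (w.take l) ((w.drop l).take n) ((w.drop l).drop n)

/-- `split_n^L(w)` for `w ∈ S_{n+1}`; the leftmost subpath in `S_n` consists of the first `n`
letters. -/
noncomputable def splitL (n : ℕ) (a : ℤ) (w : Word) : P k m n :=
  tens k m n a [] (w.take n) (w.drop n)

/-- `split_n^R(w)` for `w ∈ S_{n+1}`; the rightmost subpath in `S_n` consists of the last `n`
letters. -/
noncomputable def splitR (n : ℕ) (a : ℤ) (w : Word) : P k m n :=
  tens k m n a (w.take 1) (w.drop 1) []

/-- `x · f · y` for the outer factors `x`, `y` of a basis element `x ⊗ w ⊗ y`. -/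
noncomputable def sandwich {n : ℕ} (n' : ℕ) (t : Gen m n) (f : P k m n') : P k m n' :=
  lact k m n' (t.src + shift (t.mid ++ t.right)) t.left (ract k m n' t.src t.right f)

/-- `1 ⊗ w ⊗ 1` for a basis element `x ⊗ w ⊗ y`. -/
noncomputable def core {n : ℕ} (t : Gen m n) : P k m n :=
  tens k m n (t.src + shift t.right) [] t.mid []

/-- `δ_{n+1} : P_{n+1} → P_n`. -/
noncomputable def delta (n : ℕ) : P k m (n + 1) →ₗ[k] P k m n :=
  Finsupp.linearCombination k fun t => sandwich k m n t
    (if Even (n + 1) then split k m n (t.src + shift t.right) t.mid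
     else splitL k m n (t.src + shift t.right) t.mid - splitR k m n (t.src + shift t.right) t.mid)

/-- `γ_n : P_n → P_{n+1}`, `x ⊗ w ⊗ y ↦ (-1)^{n+1} split_{n+1}(x w) · y`. -/
noncomputable def gamma (n : ℕ) : P k m n →ₗ[k] P k m (n + 1) :=
  Finsupp.linearCombination k fun t => (-1 : k) ^ (n + 1) •
    ract k m (n + 1) t.src t.right
      (split k m (n + 1) (t.src + shift t.right) (t.left ++ t.mid))

/-- `∂_0 = δ_0 : P_0 → A`, `x ⊗ y ↦ π(x y)`. -/
noncomputable def partialZero : P k m 0 →ₗ[k] A k m :=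
  Finsupp.linearCombination k fun t => proj k m t.src (t.left ++ t.right)

/-- `ρ_{-1} = γ_{-1} : A → P_0`, `x ↦ 1 ⊗ x`; all other summands of `ρ_{-1}` vanish because
`δ_0 = ∂_0`. -/
noncomputable def rhoNegOne : A k m →ₗ[k] P k m 0 :=
  Finsupp.linearCombination k fun x => tens k m 0 x.src [] [] x.word

/-- For a candidate `d` for `∂_{n+1}` and a basis element `t` of `P_n`, the `i`-th summand
`γ_n (δ_{n+1} γ_n - d γ_n)^i (t)` of `ρ_n(t)`. -/
noncomputable def rhoSummand (n : ℕ) (d : P k m (n + 1) →ₗ[k] P k m n) (t : Gen m n) (i : ℕ) :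
    P k m (n + 1) :=
  gamma k m n (((delta k m n ∘ₗ gamma k m n - d ∘ₗ gamma k m n) ^ i) (Finsupp.single t 1))

/-- `ρ_n = γ_n + ∑_{i ≥ 1} γ_n (δ_{n+1} γ_n - ∂_{n+1} γ_n)^i`. -/
noncomputable def rhoOf (n : ℕ) (d : P k m (n + 1) →ₗ[k] P k m n) : P k m n →ₗ[k] P k m (n + 1) :=
  Finsupp.linearCombination k fun t => ∑ᶠ i : ℕ, rhoSummand k m n d t i

/-- The pair `(∂_{n+1}, ρ_n)`, where
`∂_{n+1}(x ⊗ w ⊗ y) = x · ((id - ρ_{n-1} ∂_n) δ_{n+1})(1 ⊗ w ⊗ 1) · y`. -/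
noncomputable def resolution :
    (n : ℕ) → (P k m (n + 1) →ₗ[k] P k m n) × (P k m n →ₗ[k] P k m (n + 1))
  | 0 =>
    let d := Finsupp.linearCombination k fun t : Gen m 1 => sandwich k m 0 t
      (delta k m 0 (core k m t) -
        rhoNegOne k m (partialZero k m (delta k m 0 (core k m t))))
    (d, rhoOf k m 0 d)
  | n + 1 =>
    let d := Finsupp.linearCombination k fun t : Gen m (n + 2) => sandwich k m (n + 1) t
      (delta k m (n + 1) (core k m t) -
        (resolution n).2 ((resolution n).1 (delta k m (n + 1) (core k m t))))
    (d, rhoOf k m (n + 1) d)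

/-- The differential `∂_{n+1} : P_{n+1} → P_n` of the Chouhy–Solotar resolution. -/
noncomputable def diff (n : ℕ) : P k m (n + 1) →ₗ[k] P k m n := (resolution k m n).1

/-- The map `ρ_n : P_n → P_{n+1}`. -/
noncomputable def rho (n : ℕ) : P k m n →ₗ[k] P k m (n + 1) := (resolution k m n).2

/-! ### The normalized bar resolution and the comparison map -/

/-- `∂̄_0 : Bar_0 → A`, the multiplication. -/
noncomputable def barDiffZero : Bar k m 0 →ₗ[k] A k m :=
  Finsupp.linearCombination k fun g => proj k m g.src (g.left ++ g.right)

/-- The list `[a_n, …, a_{i+1} a_i, …, a_1]` for `ys = [a_n, …, a_1]` and `1 ≤ i ≤ n - 1`. -/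
def merge (n i : ℕ) (ys : List Word) : List Word :=
  ys.take (n - 1 - i) ++ ((ys.drop (n - 1 - i)).take 2).flatten :: ys.drop (n + 1 - i)

/-- `∂̄_{n+1} : Bar_{n+1} → Bar_n`. -/
noncomputable def barDiff (n : ℕ) : Bar k m (n + 1) →ₗ[k] Bar k m n :=
  Finsupp.linearCombination k fun g =>
    barTens k m n g.src g.left g.mid.dropLast (g.mid.getLastD [] ++ g.right) +
    ∑ i ∈ Finset.Icc 1 n,
      (-1 : k) ^ i • barTens k m n g.src g.left (merge (n + 1) i g.mid) g.right +
    (-1 : k) ^ (n + 1) • barTens k m n g.src (g.left ++ g.mid.headD []) g.mid.tail g.right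

/-- The comparison map `G_n : Bar_n → P_n`:
`G_n(a ⊗ y ⊗ b) = a · ρ_{n-1} G_{n-1} ∂̄_n(1 ⊗ y ⊗ b)`, with `G_{-1} = id_A`. -/
noncomputable def G : (n : ℕ) → Bar k m n →ₗ[k] P k m n
  | 0 => Finsupp.linearCombination k fun g =>
      lact k m 0 (g.src + shift (g.mid.flatten ++ g.right)) g.left
        (rhoNegOne k m (barDiffZero k m (barTens k m 0 g.src [] g.mid g.right)))
  | n + 1 => Finsupp.linearCombination k fun g =>
      lact k m (n + 1) (g.src + shift (g.mid.flatten ++ g.right)) g.left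
        (rho k m n (G n (barDiff k m n (barTens k m (n + 1) g.src [] g.mid g.right))))

/-- The distinct terms `π(u) ⊗ r ⊗ π(v)` that occur in `split_n(w)` for some `w ⪯ w₀`, where `w₀`
is a path starting at `e_i`. -/
def splitTerms (n : ℕ) (i : ℤ) (w₀ : Word) : Set (Gen m n) :=
  {t | ∃ w, Reduces w₀ w ∧ t ∈ (split k m n i w).support}

end

/-! ### The diagrammatic description of the terms -/

/-- The path `w` starting at `e_a` goes from one side of the red strand between `e_j` and `e_{j+1}`
to the other. -/
def Crosses (j a : ℤ) (w : Word) : Prop :=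
  (a ≤ j ∧ j < a + shift w) ∨ (a + shift w ≤ j ∧ j < a)

/-- Every one of the paths `y_n, …, y_1`, where `y_n ⋯ y_1` starts at `e_i`, crosses the red strand
between `e_j` and `e_{j+1}`. -/
def AllCross (j i : ℤ) (ys : List Word) : Prop :=
  ∀ z w rest, ys = z ++ w :: rest → Crosses j (i + shift rest.flatten) w

/-- The opposite crossing. -/
def opp : Arrow → Arrow
  | p => q
  | q => p
  | s => s

/-- The path of length `n` oscillating around a red strand, with last arrow `c`. -/
def zigzag : Arrow → ℕ → Word
  | _, 0 => []
  | c, n + 1 => c :: zigzag (opp c) n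

/-- The terms obtained from `[y_n|y_{n-1}|⋯|y_1]` (`yn = y_n`, `ys = [y_{n-1}, …, y_1]`) by
splitting off an ambiguity around one red strand.  The strand has to be crossed by all of
`y_{n-1}, …, y_1`; let `c` be the crossing arrow of `y_{n-1} = y' c y''`.
Everything above it straightens to `π(y_n y') = a s^M`.  For each `0 ≤ d < M`, dropping `d` of
these `M` top dots to the bottom gives the term with left factor `a s^(M-d-1)` and the type II
ambiguity `s c c̄ c ⋯`.  If `y_n` crosses the strand as well, then dropping all top dots gives the
term with the type I ambiguity `c̄ c c̄ ⋯`, whose left factor is the part of `y_n` above the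
crossing.  The right factor is determined by the number of dots. -/
def strandTerms (m n : ℕ) (i : ℤ) (yn : Word) (ys : List Word) : Set (Gen m n) :=
  {t | t.src = i ∧ nf (t.left ++ t.mid ++ t.right) = nf (yn ++ ys.flatten) ∧
    ∃ j : ℤ, 0 ≤ j ∧ j < m ∧ AllCross j i ys ∧
    ∃ y' c y'' rest, ys = (y' ++ c :: y'') :: rest ∧
      Crosses j (i + shift (y'' ++ rest.flatten)) [c] ∧
      ((t.mid = s :: zigzag c (n - 1) ∧
          ∃ d : ℕ, nf (yn ++ y') = t.left ++ List.replicate (d + 1) s) ∨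
        (t.mid = zigzag (opp c) n ∧
          ∃ z, yn = t.left ++ opp c :: z ∧
            Crosses j (i + shift (z ++ ys.flatten)) [opp c]))}

end KLRW

/-!
A word is determined modulo the reductions by its total displacement `shift` and its degree `deg`,
so its normal form is a power of `p` or of `q` followed by dots, and an ambiguity oscillates around
a single red strand, possibly below one dot.  Following a strand through the reductions shows which
ambiguities can be created from `y_n ⋯ y_1`: the number of crossings of a strand only drops by two
adjacent opposite crossings merging into a dot, so if `y_n ⋯ y_1` reduces to a path containing an
ambiguity around a strand, then all of `y_{n-1}, …, y_1` cross this strand.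

For the maps, call `u ⊗ r ⊗ v` tight if no letter of `u` extends `r` to an ambiguity.  Then `γ`
and hence `ρ` vanish on tight tensors and take values in their span.  By induction on the degree,
modulo tight tensors the error `δ - ∂` lets the dot on top of an ambiguity slide to the bottom, and
it is tight on ambiguities without dot.  Thus `ρ(u ⊗ r ⊗ v)` absorbs the last dot of `u` into `r`
or moves it across `r`, and stops at the first crossing, which is absorbed if it extends `r`.  In
`G_n` only the last summand of the bar differential contributes, because all others are tight.
Hence `G_n(1 ⊗ [y_n|⋯|y_1] ⊗ 1)` is `±ρ_{n-1}` applied to `y_n · G_{n-1}(1 ⊗ [y_{n-1}|⋯|y_1] ⊗ 1)`,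
and the resulting terms are exactly those of the splittings of the paths `w ⪯ y_n ⋯ y_1`, each
obtained once.
-/

namespace KLRW

open Arrow Relation

/-! ### Words and normal forms -/

/-- The degree for which all rules of the reduction system are homogeneous: a dot weighs as much as
two strand crossings. Together with `shift` it determines the normal form. -/
def deg (w : Word) : ℕ := 2 * w.count s + w.count p + w.count q

theorem deg_append (u v : Word) : deg (u ++ v) = deg u + deg v := by
  simp only [deg, List.count_append]; ring

theorem deg_cons (x : Arrow) (w : Word) : deg (x :: w) = deg [x] + deg w :=
  deg_append [x] w

theorem shift_cons (x : Arrow) (w : Word) : shift (x :: w) = shift [x] + shift w :=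
  shift_append [x] w

@[simp] theorem shift_p : shift [p] = 1 := by decide
@[simp] theorem shift_q : shift [q] = -1 := by decide
@[simp] theorem shift_s : shift [s] = 0 := by decide
@[simp] theorem deg_p : deg [p] = 1 := by decide
@[simp] theorem deg_q : deg [q] = 1 := by decide
@[simp] theorem deg_s : deg [s] = 2 := by decide

theorem shift_s_cons (w : Word) : shift (s :: w) = shift w := by
  rw [shift_cons, shift_s, zero_add]

theorem shift_replicate (n : ℕ) (x : Arrow) : shift (List.replicate n x) = n * shift [x] := by
  induction n with
  | zero => simp [shift_nil]
  | succ n ih => rw [List.replicate_succ, shift_cons, ih]; push_cast; ring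

@[simp] theorem shift_dots (n : ℕ) : shift (List.replicate n s) = 0 := by
  rw [shift_replicate, shift_s, mul_zero]

theorem deg_replicate (n : ℕ) (x : Arrow) : deg (List.replicate n x) = n * deg [x] := by
  induction n with
  | zero => simp [deg]
  | succ n ih => rw [List.replicate_succ, deg_cons, ih]; ring

theorem deg_nf (w : Word) : deg (nf w) = deg w := by
  simp only [nf, deg_append, deg_replicate, deg_p, deg_q, deg_s]
  unfold deg
  omega

theorem nf_eq_nf_iff {u v : Word} : nf u = nf v ↔ shift u = shift v ∧ deg u = deg v := by
  constructor
  · intro h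
    exact ⟨by rw [← shift_nf u, h, shift_nf], by rw [← deg_nf u, h, deg_nf]⟩
  · rintro ⟨hshift, hdeg⟩
    unfold shift at hshift
    unfold deg at hdeg
    unfold nf
    congr 1
    · congr 2 <;> omega
    · congr 1; omega

theorem nf_append_congr {u u' v v' : Word} (hu : nf u = nf u') (hv : nf v = nf v') :
    nf (u ++ v) = nf (u' ++ v') := by
  rw [nf_eq_nf_iff] at *
  simp only [shift_append, deg_append, hu, hv, and_self]

theorem irr_iff {w : Word} : Irr w ↔ nf w = w :=
  ⟨fun h => (nf_unique ReflTransGen.refl h).symm, fun h => h ▸ irr_nf w⟩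

theorem Irr.nf_eq {w : Word} (h : Irr w) : nf w = w := irr_iff.1 h

theorem nf_nf (w : Word) : nf (nf w) = nf w := (irr_nf w).nf_eq

theorem nf_append_nf (u v : Word) : nf (u ++ nf v) = nf (u ++ v) := nf_append_congr rfl (nf_nf v)

theorem nf_nf_append (u v : Word) : nf (nf u ++ v) = nf (u ++ v) := nf_append_congr (nf_nf u) rfl

theorem Irr.of_infix {u v : Word} (h : Irr v) (huv : u <:+: v) : Irr u :=
  fun t ht htu => h t ht (htu.trans huv)

theorem Irr.of_append_left {u v : Word} (h : Irr (u ++ v)) : Irr u :=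
  h.of_infix (List.prefix_append u v).isInfix

theorem Irr.of_append_right {u v : Word} (h : Irr (u ++ v)) : Irr v :=
  h.of_infix (List.suffix_append u v).isInfix

protected theorem Reduces.refl (w : Word) : Reduces w w := ReflTransGen.refl

protected theorem Reduces.trans {u v w : Word} (huv : Reduces u v) (hvw : Reduces v w) :
    Reduces u w := ReflTransGen.trans huv hvw

theorem Step.reduces {w w' : Word} (h : Step w w') : Reduces w w' := ReflTransGen.single h

theorem Reduces.nf_eq {w w' : Word} (h : Reduces w w') : nf w' = nf w := by
  induction h with
  | refl => rfl
  | tail _ hs ih => rw [step_nf hs, ih]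

theorem Reduces.shift_eq {w w' : Word} (h : Reduces w w') : shift w' = shift w :=
  (nf_eq_nf_iff.1 h.nf_eq).1

theorem Reduces.of_nf_eq {w w' : Word} (h : nf w = w') : Reduces w w' := h ▸ reduces_nf w

theorem Reduces.append_left {w w' : Word} (u : Word) (h : Reduces w w') :
    Reduces (u ++ w) (u ++ w') := by
  simpa only [List.append_nil] using reduces_context u [] h

theorem Reduces.append_right {w w' : Word} (v : Word) (h : Reduces w w') :
    Reduces (w ++ v) (w' ++ v) := reduces_context [] v h

theorem Reduces.eq_of_irr {u v : Word} (h : Reduces u v) (hu : Irr u) : v = u := by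
  rcases ReflTransGen.cases_head h with h | ⟨_, hstep, _⟩
  · exact h.symm
  · exact absurd hstep (irr_not_step hu)

@[simp] theorem opp_opp (c : Arrow) : opp (opp c) = c := by cases c <;> rfl

theorem opp_ne_s {c : Arrow} (hc : c ≠ s) : opp c ≠ s := by
  cases c <;> simp_all [opp]

theorem shift_opp (c : Arrow) : shift [opp c] = - shift [c] := by
  cases c <;> decide

theorem shift_eq_one_or_neg_one {c : Arrow} (hc : c ≠ s) : shift [c] = 1 ∨ shift [c] = -1 := by
  cases c <;> simp_all

theorem Rule.exists_eq_pair {t f : Word} (h : Rule t f) : ∃ x y, t = [x, y] := by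
  cases h <;> exact ⟨_, _, rfl⟩

theorem rule_s {c : Arrow} (hc : c ≠ s) : Rule [s, c] [c, s] := by
  cases c
  · exact Rule.sp
  · exact Rule.sq
  · exact absurd rfl hc

theorem rule_opp {c : Arrow} (hc : c ≠ s) : Rule [opp c, c] [s] := by
  cases c
  · exact Rule.qp
  · exact Rule.pq
  · exact absurd rfl hc

theorem Rule.eq_of_s {c : Arrow} {f : Word} (h : Rule [s, c] f) : f = [c, s] := by
  cases h <;> rfl

theorem Rule.eq_of_opp {c : Arrow} {f : Word} (h : Rule [opp c, c] f) : f = [s] := by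
  generalize e : [opp c, c] = t at h
  cases h <;> cases c <;> simp [opp] at e ⊢

theorem inS_s {c : Arrow} (hc : c ≠ s) : InS [s, c] := ⟨_, rule_s hc⟩

theorem inS_opp {c : Arrow} (hc : c ≠ s) : InS [opp c, c] := ⟨_, rule_opp hc⟩

theorem inS_iff {x y : Arrow} : InS [x, y] ↔ y ≠ s ∧ (x = s ∨ x = opp y) := by
  constructor
  · rintro ⟨f, hf⟩
    cases hf <;> simp [opp]
  · rintro ⟨h, rfl | rfl⟩
    · exact inS_s h
    · exact inS_opp h

theorem irr_nil : Irr [] := irr_iff.2 rfl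

theorem irr_singleton (x : Arrow) : Irr [x] := irr_iff.2 (by cases x <;> rfl)

theorem irr_replicate_append_dots {c : Arrow} (hc : c ≠ s) (a b : ℕ) :
    Irr (List.replicate a c ++ List.replicate b s) := by
  rw [irr_iff]
  cases c
  · simp [nf, List.count_append, List.count_replicate]
  · simp [nf, List.count_append, List.count_replicate]
  · exact absurd rfl hc

theorem irr_replicate {c : Arrow} (hc : c ≠ s) (a : ℕ) : Irr (List.replicate a c) := by
  simpa using irr_replicate_append_dots hc a 0

theorem Irr.exists_eq_replicate_append_dots {w : Word} (h : Irr w) :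
    ∃ (c : Arrow) (a b : ℕ), c ≠ s ∧ w = List.replicate a c ++ List.replicate b s := by
  have hw := h.nf_eq
  rw [nf] at hw
  rcases le_total (w.count p) (w.count q) with hle | hle
  · rw [Nat.sub_eq_zero_of_le hle, List.replicate_zero, List.nil_append] at hw
    exact ⟨q, _, _, by simp, hw.symm⟩
  · rw [Nat.sub_eq_zero_of_le hle, List.replicate_zero, List.append_nil] at hw
    exact ⟨p, _, _, by simp, hw.symm⟩

theorem Irr.left_eq_replicate {c : Arrow} (hc : c ≠ s) {u v : Word} (h : Irr (u ++ c :: v)) :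
    ∃ l, u = List.replicate l c := by
  induction u using List.reverseRecOn generalizing v with
  | nil => exact ⟨0, rfl⟩
  | append_singleton u x ih =>
    have hxc : x = c := by
      have hS : ¬ InS [x, c] := fun hS => h _ hS ⟨u, v, by simp⟩
      rw [inS_iff] at hS
      cases x <;> cases c <;> simp_all [opp]
    subst hxc
    obtain ⟨l, rfl⟩ := ih (v := x :: v) (by simpa using h)
    exact ⟨l + 1, List.replicate_succ'.symm⟩

theorem Irr.exists_eq_replicate_of_cons {c : Arrow} (hc : c ≠ s) {v : Word} (h : Irr (c :: v)) :
    ∃ b d, v = List.replicate b c ++ List.replicate d s := by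
  obtain ⟨x, a, d, -, hv⟩ := h.exists_eq_replicate_append_dots
  rcases a with - | a
  · have hmem : c ∈ List.replicate d s := by
      rw [List.replicate_zero, List.nil_append] at hv
      exact hv ▸ List.mem_cons_self
    exact absurd (List.eq_of_mem_replicate hmem) hc
  · rw [List.replicate_succ, List.cons_append, List.cons.injEq] at hv
    obtain ⟨rfl, hv⟩ := hv
    exact ⟨a, d, hv⟩

/-! ### Ambiguities -/

theorem amb_cons_cons {n : ℕ} {x y : Arrow} {w : Word} :
    Amb (n + 1) (x :: y :: w) ↔ InS [x, y] ∧ Amb n (y :: w) := by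
  simp only [Amb, List.length_cons, List.isChain_cons_cons, Nat.add_right_cancel_iff]
  tauto

theorem amb_nil : Amb 0 [] := ⟨rfl, List.isChain_nil⟩

theorem amb_singleton (x : Arrow) : Amb 1 [x] := ⟨rfl, List.isChain_singleton x⟩

theorem amb_cons_iff_eq_zigzag {n : ℕ} {c : Arrow} {w : Word} (hc : c ≠ s) :
    Amb (n + 1) (c :: w) ↔ c :: w = zigzag c (n + 1) := by
  induction n generalizing c w with
  | zero =>
    rw [zigzag, zigzag, List.cons.injEq, eq_self, true_and]
    constructor
    · rintro ⟨hlen, -⟩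
      simpa using hlen
    · rintro rfl
      exact amb_singleton c
  | succ n ih =>
    rcases w with - | ⟨y, w⟩
    · simp [Amb, zigzag]
    have hS : InS [c, y] ↔ y = opp c := by cases c <;> cases y <;> simp [inS_iff, opp] at hc ⊢
    rw [amb_cons_cons, hS, zigzag, List.cons.injEq, eq_self, true_and]
    constructor
    · rintro ⟨rfl, h⟩
      exact (ih (opp_ne_s hc)).1 h
    · intro h
      obtain rfl : y = opp c := (List.cons.inj h).1
      exact ⟨rfl, (ih (opp_ne_s hc)).2 h⟩

theorem amb_zigzag {c : Arrow} (hc : c ≠ s) (n : ℕ) : Amb n (zigzag c n) := by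
  cases n with
  | zero => exact amb_nil
  | succ n => exact (amb_cons_iff_eq_zigzag hc).2 rfl

theorem Amb.eq_zigzag_or_eq_s_cons_zigzag {n : ℕ} {w : Word} (h : Amb (n + 2) w) :
    ∃ c, c ≠ s ∧ (w = zigzag c (n + 2) ∨ w = s :: zigzag c (n + 1)) := by
  rcases w with - | ⟨x, - | ⟨y, w⟩⟩
  · simp [Amb] at h
  · simp [Amb] at h
  by_cases hx : x = s
  · subst hx
    rw [amb_cons_cons, inS_iff] at h
    exact ⟨y, h.1.1, Or.inr (by rw [(amb_cons_iff_eq_zigzag h.1.1).1 h.2])⟩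
  · exact ⟨x, hx, Or.inl ((amb_cons_iff_eq_zigzag hx).1 h)⟩

theorem Amb.take {n : ℕ} {w : Word} (h : Amb (n + 1) w) : Amb n (w.take n) :=
  ⟨by rw [List.length_take, h.1]; simp, h.2.take n⟩

theorem Amb.tail {n : ℕ} {x : Arrow} {w : Word} (h : Amb (n + 1) (x :: w)) : Amb n w :=
  ⟨by simpa using h.1, h.2.tail⟩

theorem reduces_s_cons_zigzag {c : Arrow} (hc : c ≠ s) (n : ℕ) :
    Reduces (s :: zigzag c n) (zigzag c n ++ [s]) := by
  induction n generalizing c with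
  | zero => exact .refl _
  | succ n ih =>
    have hstep : Step (s :: zigzag c (n + 1)) ([c] ++ s :: zigzag (opp c) n) :=
      Step.mk [] _ _ (zigzag (opp c) n) (rule_s hc)
    exact ReflTransGen.head hstep ((ih (opp_ne_s hc)).append_left [c])

theorem reduces_dots_append_zigzag {c : Arrow} (hc : c ≠ s) (d n : ℕ) :
    Reduces (List.replicate d s ++ zigzag c n) (zigzag c n ++ List.replicate d s) := by
  induction d with
  | zero =>
    rw [List.replicate_zero, List.append_nil]
    exact .refl _
  | succ d ih =>
    have hinner := ih.append_left [s]
    have houter := (reduces_s_cons_zigzag hc n).append_right (List.replicate d s)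
    rw [List.append_assoc] at houter
    exact hinner.trans houter

/-! ### Crossings of a red strand -/

theorem crosses_singleton {j a : ℤ} {c : Arrow} :
    Crosses j a [c] ↔ (c = p ∧ a = j) ∨ (c = q ∧ a = j + 1) := by
  cases c <;> simp [Crosses] <;> omega

theorem not_crosses_s {j a : ℤ} : ¬ Crosses j a [s] := by
  simp [crosses_singleton]

theorem Crosses.ne_s {j a : ℤ} {c : Arrow} (h : Crosses j a [c]) : c ≠ s := by
  rintro rfl
  exact not_crosses_s h

theorem crosses_opp_iff {j a : ℤ} {c : Arrow} :
    Crosses j (a + shift [c]) [opp c] ↔ Crosses j a [c] := by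
  cases c <;> simp [crosses_singleton, opp]; omega

theorem crosses_opp_cons_iff {j a : ℤ} {c : Arrow} {w : Word} :
    Crosses j (a + shift (c :: w)) [opp c] ↔ Crosses j (a + shift w) [c] := by
  rw [shift_cons, add_comm (shift [c]), ← add_assoc, crosses_opp_iff]

open Classical in
/-- The number of arrows of the path `w`, starting at `e_a`, which cross the strand between `e_j`
and `e_{j+1}`. -/
noncomputable def crossings (j a : ℤ) : Word → ℕ
  | [] => 0
  | x :: w => crossings j a w + if Crosses j (a + shift w) [x] then 1 else 0

theorem crossings_append (j a : ℤ) (u v : Word) :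
    crossings j a (u ++ v) = crossings j a v + crossings j (a + shift v) u := by
  induction u with
  | nil => rfl
  | cons x u ih =>
    rw [List.cons_append, crossings, crossings, ih, shift_append, add_comm (shift u), ← add_assoc,
      add_assoc]

theorem crossings_cons_of_crosses {j a : ℤ} {x : Arrow} {w : Word}
    (h : Crosses j (a + shift w) [x]) : crossings j a (x :: w) = crossings j a w + 1 := by
  rw [crossings, if_pos h]

theorem crossings_cons_of_not_crosses {j a : ℤ} {x : Arrow} {w : Word}
    (h : ¬ Crosses j (a + shift w) [x]) : crossings j a (x :: w) = crossings j a w := by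
  rw [crossings, if_neg h, add_zero]

theorem crossings_s_cons (j a : ℤ) (w : Word) : crossings j a (s :: w) = crossings j a w :=
  crossings_cons_of_not_crosses not_crosses_s

theorem crossings_dots (j a : ℤ) (n : ℕ) : crossings j a (List.replicate n s) = 0 := by
  induction n with
  | zero => rfl
  | succ n ih => rw [List.replicate_succ, crossings_s_cons, ih]

theorem crossings_opp_cons_cons {j a : ℤ} {c : Arrow} {w : Word}
    (h : Crosses j (a + shift w) [c]) :
    crossings j a (opp c :: c :: w) = crossings j a w + 2 := by
  rw [crossings_cons_of_crosses (crosses_opp_cons_iff.2 h), crossings_cons_of_crosses h]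

theorem odd_crossings_iff (j a : ℤ) (w : Word) : Odd (crossings j a w) ↔ Crosses j a w := by
  induction w with
  | nil => simp [crossings, Crosses, shift_nil]
  | cons x w ih =>
    have hcons : Crosses j a (x :: w) ↔ (Crosses j a w ↔ ¬ Crosses j (a + shift w) [x]) := by
      simp only [Crosses, shift_cons x w]
      cases x <;> simp only [shift_p, shift_q, shift_s] <;> omega
    by_cases h : Crosses j (a + shift w) [x]
    · rw [crossings_cons_of_crosses h, Nat.odd_add_one, ih, hcons]
      tauto
    · rw [crossings_cons_of_not_crosses h, ih, hcons]
      simp only [h, not_false_eq_true, iff_true]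

theorem crossings_replicate_le_one (j a : ℤ) (n : ℕ) (c : Arrow) :
    crossings j a (List.replicate n c) ≤ 1 := by
  induction n with
  | zero => exact Nat.zero_le 1
  | succ n ih =>
    rw [List.replicate_succ]
    by_cases h : Crosses j (a + shift (List.replicate n c)) [c]
    · have hbelow : ¬ Crosses j a (List.replicate n c) := by
        rw [Crosses, shift_replicate] at *
        cases c <;> simp only [shift_p, shift_q, shift_s] at * <;> omega
      rw [← odd_crossings_iff, Nat.not_odd_iff_even, Nat.even_iff] at hbelow
      rw [crossings_cons_of_crosses h]
      omega
    · rwa [crossings_cons_of_not_crosses h]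

theorem Irr.crossings_le_one {w : Word} (h : Irr w) (j a : ℤ) : crossings j a w ≤ 1 := by
  obtain ⟨c, n, b, -, rfl⟩ := h.exists_eq_replicate_append_dots
  rw [crossings_append, crossings_dots, zero_add]
  exact crossings_replicate_le_one _ _ _ _

theorem Irr.crossings_eq_one_iff {w : Word} (h : Irr w) {j a : ℤ} :
    crossings j a w = 1 ↔ Crosses j a w := by
  have hle := h.crossings_le_one j a
  rw [← odd_crossings_iff, Nat.odd_iff]
  omega

theorem exists_crossing_of_crossings_ne_zero {j a : ℤ} {w : Word} (h : crossings j a w ≠ 0) :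
    ∃ u c v, w = u ++ c :: v ∧ Crosses j (a + shift v) [c] := by
  induction w with
  | nil => exact absurd rfl h
  | cons x w ih =>
    by_cases hx : Crosses j (a + shift w) [x]
    · exact ⟨[], x, w, rfl, hx⟩
    · rw [crossings_cons_of_not_crosses hx] at h
      obtain ⟨u, c, v, rfl, hc⟩ := ih h
      exact ⟨x :: u, c, v, rfl, hc⟩

theorem Irr.crossings_append_eq {j a : ℤ} {u v w : Word} {c : Arrow} (h : Irr (u ++ c :: v))
    (hc : Crosses j (a + shift (v ++ w)) [c]) : crossings j a (v ++ w) = crossings j a w := by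
  rw [shift_append, add_comm (shift v), ← add_assoc] at hc
  have hle := h.crossings_le_one j (a + shift w)
  rw [crossings_append, crossings_cons_of_crosses hc] at hle
  rw [crossings_append]
  omega

theorem Irr.exists_crossing {j a : ℤ} {y w : Word} (hy : Irr y)
    (h : Crosses j (a + shift w) y) :
    ∃ u c v, y = u ++ c :: v ∧ Crosses j (a + shift (v ++ w)) [c] := by
  obtain ⟨u, c, v, rfl, hc⟩ := exists_crossing_of_crossings_ne_zero
    (by rw [hy.crossings_eq_one_iff.2 h]; exact one_ne_zero)
  refine ⟨u, c, v, rfl, ?_⟩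
  rwa [shift_append, add_comm (shift v), ← add_assoc]

theorem Irr.crosses_of_crossing {j a : ℤ} {u v w : Word} {c : Arrow} (h : Irr (u ++ c :: v))
    (hc : Crosses j (a + shift (v ++ w)) [c]) : Crosses j (a + shift w) (u ++ c :: v) := by
  rw [shift_append, add_comm (shift v), ← add_assoc] at hc
  have hle := h.crossings_le_one j (a + shift w)
  rw [← h.crossings_eq_one_iff]
  rw [crossings_append, crossings_cons_of_crosses hc] at hle ⊢
  omega

theorem crossings_flatten_le {j i : ℤ} {ys : List Word} (hys : ∀ y ∈ ys, Irr y) :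
    crossings j i ys.flatten ≤ ys.length := by
  induction ys with
  | nil => exact le_rfl
  | cons y ys ih =>
    rw [List.forall_mem_cons] at hys
    rw [List.flatten_cons, crossings_append, List.length_cons]
    exact add_le_add (ih hys.2) (hys.1.crossings_le_one _ _)

theorem allCross_nil (j i : ℤ) : AllCross j i [] := by
  intro z w rest h
  simp at h

theorem allCross_cons {j i : ℤ} {y : Word} {ys : List Word} :
    AllCross j i (y :: ys) ↔ Crosses j (i + shift ys.flatten) y ∧ AllCross j i ys := by
  constructor
  · intro h
    exact ⟨h [] y ys rfl, fun z w rest hys => h (y :: z) w rest (by rw [hys, List.cons_append])⟩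
  · rintro ⟨hy, hys⟩ (- | ⟨x, z⟩) w rest hsplit
    · obtain ⟨rfl, rfl⟩ := List.cons.inj hsplit
      exact hy
    · exact hys z w rest (List.cons.inj hsplit).2

theorem crossings_flatten_eq_length_iff {j i : ℤ} {ys : List Word} (hys : ∀ y ∈ ys, Irr y) :
    crossings j i ys.flatten = ys.length ↔ AllCross j i ys := by
  induction ys with
  | nil => simp [crossings, allCross_nil]
  | cons y ys ih =>
    rw [List.forall_mem_cons] at hys
    rw [allCross_cons, ← ih hys.2, ← hys.1.crossings_eq_one_iff, List.flatten_cons,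
      crossings_append, List.length_cons]
    have htail := crossings_flatten_le (j := j) (i := i) hys.2
    have hhead := hys.1.crossings_le_one j (i + shift ys.flatten)
    omega

theorem eq_of_append_crossing_eq {j a : ℤ} {x x' : Arrow} {u u' v v' : Word}
    (h : u ++ x :: v = u' ++ x' :: v') (hx : Crosses j (a + shift v) [x])
    (hx' : Crosses j (a + shift v') [x']) (hv : crossings j a v = crossings j a v') :
    u = u' ∧ x = x' ∧ v = v' := by
  have hlt {x₂ : Arrow} {l v₁ v₂ : Word} (h : v₁ = l ++ x₂ :: v₂)
      (hx₂ : Crosses j (a + shift v₂) [x₂]) : crossings j a v₁ ≠ crossings j a v₂ := by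
    rw [h, crossings_append, crossings_cons_of_crosses hx₂]
    omega
  rcases List.append_eq_append_iff.1 h with ⟨- | ⟨y, l⟩, hu, hl⟩ | ⟨- | ⟨y, l⟩, hu, hl⟩
  · rw [List.append_nil] at hu
    exact ⟨hu.symm, List.cons.inj hl⟩
  · exact absurd hv (hlt (List.cons.inj hl).2 hx')
  · rw [List.append_nil] at hu
    exact ⟨hu, (List.cons.inj hl).1.symm, (List.cons.inj hl).2.symm⟩
  · exact absurd hv.symm (hlt (List.cons.inj hl).2 hx)

theorem crossings_zigzag_append {j a : ℤ} {c : Arrow} {n : ℕ} {v : Word}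
    (h : Crosses j (a + shift (zigzag (opp c) n ++ v)) [c]) :
    crossings j a (zigzag (opp c) n ++ v) = crossings j a v + n := by
  induction n generalizing c with
  | zero => rfl
  | succ n ih =>
    have hnext : Crosses j (a + shift (zigzag (opp (opp c)) n ++ v)) [opp c] := by
      rw [← crosses_opp_cons_iff]
      simpa only [zigzag, List.cons_append, opp_opp] using h
    rw [zigzag, List.cons_append, crossings_cons_of_crosses hnext, ih hnext, add_assoc]

theorem IsPath.exists_strand {m : ℕ} {a : ℤ} {c : Arrow} {w : Word} (hc : c ≠ s)
    (h : IsPath m a (c :: w)) : ∃ j : ℤ, 0 ≤ j ∧ j < m ∧ Crosses j (a + shift w) [c] := by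
  obtain ⟨hw, htgt⟩ := (isPath_cons m a c w).1 h
  have hsrc := hw w List.suffix_rfl
  rw [shift_cons] at htgt
  cases c <;> simp only [shift_p, shift_q, shift_s] at htgt
  · exact ⟨a + shift w, by omega, by omega, by simp [crosses_singleton]⟩
  · exact ⟨a + shift w - 1, by omega, by omega, by simp [crosses_singleton]⟩
  · exact absurd rfl hc

theorem Crosses.strand_bounds {m : ℕ} {j a : ℤ} {u w : Word} {c : Arrow}
    (hc : Crosses j (a + shift w) [c]) (h : IsPath m a (u ++ c :: w)) : 0 ≤ j ∧ j < m := by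
  obtain ⟨hw, htgt⟩ := (isPath_cons m a c w).1 ((isPath_append m a u (c :: w)).1 h).1
  have hsrc := hw w List.suffix_rfl
  rw [shift_cons] at htgt
  rcases crosses_singleton.1 hc with ⟨rfl, h⟩ | ⟨rfl, h⟩ <;>
    simp only [shift_p, shift_q] at htgt <;> omega

/-! ### Crossings along reductions -/

theorem Step.crossings_le {w w' : Word} (h : Step w w') (j a : ℤ) :
    crossings j a w' ≤ crossings j a w := by
  obtain ⟨u, t, f, v, hr⟩ := h
  have hrule : crossings j (a + shift v) f ≤ crossings j (a + shift v) t := by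
    generalize a + shift v = b
    cases hr <;> simp [crossings, crosses_singleton, shift_nil]
  simp only [crossings_append, rule_shift hr]
  omega

theorem Reduces.crossings_le {w w' : Word} (h : Reduces w w') (j a : ℤ) :
    crossings j a w' ≤ crossings j a w := by
  induction h with
  | refl => exact le_rfl
  | tail _ hs ih => exact (hs.crossings_le j a).trans ih

theorem crossings_cancel_lt {j a : ℤ} {c : Arrow} {u v : Word} (h : Crosses j (a + shift v) [c]) :
    crossings j a (u ++ s :: v) < crossings j a (u ++ opp c :: c :: v) := by
  have hshift : shift (opp c :: c :: v) = shift (s :: v) := by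
    rw [shift_cons, shift_cons c, shift_opp, shift_s_cons, neg_add_cancel_left]
  rw [crossings_append, crossings_append, hshift, crossings_opp_cons_cons h, crossings_s_cons]
  omega

theorem step_append_cons {u v w : Word} {x : Arrow} (h : Step (u ++ x :: v) w) :
    (∃ u', Step u u' ∧ w = u' ++ x :: v) ∨ (∃ v', Step v v' ∧ w = u ++ x :: v') ∨
    (∃ u' y f, u = u' ++ [y] ∧ Rule [y, x] f ∧ w = u' ++ f ++ v) ∨
    (∃ y f v', v = y :: v' ∧ Rule [x, y] f ∧ w = u ++ f ++ v') := by
  generalize e : u ++ x :: v = w₀ at h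
  obtain ⟨u₀, t, f, v₀, hr⟩ := h
  obtain ⟨y, z, rfl⟩ := hr.exists_eq_pair
  rw [List.append_assoc, List.append_eq_append_iff] at e
  rcases e with ⟨l, rfl, htail⟩ | ⟨l, rfl, htail⟩
  · rcases l with - | ⟨b, l⟩
    · obtain ⟨rfl, rfl⟩ := List.cons.inj htail
      exact .inr (.inr (.inr ⟨z, f, v₀, rfl, hr, by simp⟩))
    · obtain ⟨rfl, rfl⟩ := List.cons.inj htail
      exact .inr (.inl ⟨l ++ f ++ v₀, by simpa using Step.mk l [y, z] f v₀ hr, by simp⟩)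
  · rcases l with - | ⟨b, - | ⟨b', l⟩⟩ <;>
      simp only [List.nil_append, List.cons_append, List.cons.injEq] at htail
    · obtain ⟨rfl, rfl⟩ := htail
      exact .inr (.inr (.inr ⟨z, f, v₀, rfl, hr, by simp⟩))
    · obtain ⟨rfl, rfl, rfl⟩ := htail
      exact .inr (.inr (.inl ⟨u₀, y, f, rfl, hr, rfl⟩))
    · obtain ⟨rfl, rfl, rfl⟩ := htail
      exact .inl ⟨u₀ ++ f ++ l, by simpa using Step.mk u₀ [y, z] f l hr, by simp⟩

theorem Step.track {j a : ℤ} {u v w : Word} {x : Arrow} (h : Step (u ++ x :: v) w)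
    (hx : Crosses j (a + shift v) [x]) (hw : crossings j a (u ++ x :: v) ≤ crossings j a w) :
    ∃ u' v' d, w = u' ++ x :: v' ∧ shift v' = shift v ∧
      Reduces u (u' ++ List.replicate d s) ∧ crossings j a v' ≤ crossings j a v := by
  rcases step_append_cons h with ⟨u', hu, rfl⟩ | ⟨v', hv, rfl⟩ | ⟨u', y, f, rfl, hf, rfl⟩ |
    ⟨y, f, v', rfl, hf, rfl⟩
  · exact ⟨u', v, 0, rfl, rfl, by simpa using hu.reduces, le_rfl⟩
  · refine ⟨u, v', 0, rfl, hv.reduces.shift_eq, ?_, hv.crossings_le j a⟩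
    simpa using Reduces.refl u
  · rcases (inS_iff.1 ⟨f, hf⟩).2 with rfl | rfl
    · obtain rfl := hf.eq_of_s
      exact ⟨u', s :: v, 1, by simp, shift_s_cons v, ReflTransGen.refl, (crossings_s_cons j a v).le⟩
    · obtain rfl := hf.eq_of_opp
      have hlt := crossings_cancel_lt (u := u') hx
      simp only [List.append_assoc, List.singleton_append] at hw
      omega
  · obtain ⟨-, rfl | rfl⟩ := inS_iff.1 ⟨f, hf⟩
    · exact absurd hx not_crosses_s
    · obtain rfl := hf.eq_of_opp
      have hlt := crossings_cancel_lt (u := u) (crosses_opp_cons_iff.1 hx)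
      simp only [List.append_assoc, List.singleton_append] at hw
      omega

/-- A crossing can only disappear by cancellation with a second one, and dots are the only letters
that pass through it. -/
theorem Reduces.track {j a : ℤ} {u v w : Word} {x : Arrow} (h : Reduces (u ++ x :: v) w)
    (hx : Crosses j (a + shift v) [x]) (hw : crossings j a w = crossings j a (u ++ x :: v)) :
    ∃ u' v' d, w = u' ++ x :: v' ∧ Crosses j (a + shift v') [x] ∧
      Reduces u (u' ++ List.replicate d s) ∧ crossings j a v' = crossings j a v := by
  suffices H : ∃ u' v' d, w = u' ++ x :: v' ∧ shift v' = shift v ∧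
      Reduces u (u' ++ List.replicate d s) ∧ crossings j a v' ≤ crossings j a v by
    obtain ⟨u', v', d, rfl, hshift, hu, hv⟩ := H
    have hx' : Crosses j (a + shift v') [x] := by rwa [hshift]
    have hu_le := hu.crossings_le j (a + shift (x :: v))
    have hshift' : shift (x :: v') = shift (x :: v) := by rw [shift_cons, hshift, ← shift_cons]
    rw [crossings_append, crossings_dots, shift_dots, add_zero, zero_add] at hu_le
    rw [crossings_append, crossings_append, crossings_cons_of_crosses hx,
      crossings_cons_of_crosses hx', hshift'] at hw
    exact ⟨u', v', d, rfl, hx', hu, by omega⟩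
  induction h with
  | refl => exact ⟨u, v, 0, rfl, rfl, by simpa using Reduces.refl u, le_rfl⟩
  | tail hr hs ih =>
    have hr_le := Reduces.crossings_le hr j a
    have hs_le := hs.crossings_le j a
    obtain ⟨u₁, v₁, d₁, rfl, hshift₁, hu₁, hv₁⟩ := ih (by omega)
    obtain ⟨u₂, v₂, d₂, rfl, hshift₂, hu₂, hv₂⟩ := hs.track (by rwa [hshift₁]) (by omega)
    refine ⟨u₂, v₂, d₂ + d₁, rfl, hshift₂.trans hshift₁, ?_, hv₂.trans hv₁⟩
    rw [List.replicate_add, ← List.append_assoc]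
    exact hu₁.trans (hu₂.append_right _)

theorem Reduces.eq_of_crossings_eq {j a : ℤ} {u u' v v' : Word} {x x' : Arrow}
    (h : Reduces (u ++ x :: v) (u' ++ x' :: v')) (hx : Crosses j (a + shift v) [x])
    (hx' : Crosses j (a + shift v') [x']) (hv : crossings j a v' = crossings j a v)
    (hw : crossings j a (u' ++ x' :: v') = crossings j a (u ++ x :: v)) :
    x' = x ∧ ∃ d, Reduces u (u' ++ List.replicate d s) := by
  obtain ⟨u₁, v₁, d, heq, hx₁, hu, hv₁⟩ := h.track hx hw
  obtain ⟨rfl, rfl, rfl⟩ := eq_of_append_crossing_eq heq hx' hx₁ (hv.trans hv₁.symm)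
  exact ⟨rfl, d, hu⟩

/-! ### Straightening above a strand -/

theorem Irr.s_notMem_left {c : Arrow} (hc : c ≠ s) {u v : Word} (h : Irr (u ++ c :: v)) :
    s ∉ u := by
  obtain ⟨l, rfl⟩ := h.left_eq_replicate hc
  exact fun hs => hc (List.eq_of_mem_replicate hs).symm

theorem Irr.eq_of_reduces_append_dots {u u' v : Word} {c : Arrow} {d : ℕ} (h : Irr (u ++ c :: v))
    (hc : c ≠ s) (hu : Reduces u (u' ++ List.replicate d s)) : u' = u := by
  have heq := hu.eq_of_irr h.of_append_left
  cases d with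
  | zero => simpa only [List.replicate_zero, List.append_nil] using heq
  | succ d => exact absurd (heq ▸ by simp [List.replicate_succ]) (h.s_notMem_left hc)

theorem eq_opp_of_crosses_of_crosses {j i : ℤ} {u v u₁ v₁ w : Word} {c c₁ : Arrow}
    (hy₁ : Irr (u₁ ++ c₁ :: v₁)) (hy : Irr (u ++ c :: v))
    (hc₁ : Crosses j (i + shift (v₁ ++ w)) [c₁])
    (hc : Crosses j (i + shift (v ++ (u₁ ++ c₁ :: v₁ ++ w))) [c]) :
    c = opp c₁ ∧ shift (v ++ u₁) = 0 := by
  obtain ⟨l, rfl⟩ := hy₁.left_eq_replicate hc₁.ne_s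
  obtain ⟨b, d, rfl⟩ := hy.of_append_right.exists_eq_replicate_of_cons hc.ne_s
  simp only [crosses_singleton, shift_append, shift_cons _ v₁, shift_replicate] at hc hc₁ ⊢
  rcases hc₁ with ⟨rfl, hc₁⟩ | ⟨rfl, hc₁⟩ <;> rcases hc with ⟨rfl, hc⟩ | ⟨rfl, hc⟩ <;>
    simp only [shift_p, shift_q, shift_s, opp] at hc hc₁ ⊢ <;> grind

theorem reduces_dots_of_shift_eq_zero {w : Word} (h : shift w = 0) :
    ∃ M, Reduces w (List.replicate M s) := by
  refine ⟨_, .of_nf_eq (w' := List.replicate (w.count s + min (w.count p) (w.count q)) s) ?_⟩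
  have hcount : w.count p = w.count q := by
    unfold shift at h
    omega
  simp [nf, hcount]

theorem AllCross.reduces {j i : ℤ} {ys : List Word} {u z : Word} {c : Arrow}
    (h : AllCross j i ys) (hys : ∀ y ∈ ys, Irr y) (hy : Irr (u ++ c :: z))
    (hc : Crosses j (i + shift (z ++ ys.flatten)) [c]) :
    ∃ v, Reduces (u ++ c :: z ++ ys.flatten) (u ++ zigzag c (ys.length + 1) ++ v) := by
  induction ys generalizing u c z with
  | nil => exact ⟨z, by simpa [zigzag] using Reduces.refl _⟩
  | cons y ys ih =>
    rw [List.forall_mem_cons] at hys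
    obtain ⟨hcross, hall⟩ := allCross_cons.1 h
    obtain ⟨u₁, c₁, z₁, rfl, hc₁⟩ := hys.1.exists_crossing hcross
    obtain ⟨v, hbelow⟩ := ih hall hys.2 hys.1 hc₁
    obtain ⟨rfl, hshift⟩ :=
      eq_opp_of_crosses_of_crosses hys.1 hy hc₁ (by simpa only [List.flatten_cons] using hc)
    obtain ⟨M, hdots⟩ := reduces_dots_of_shift_eq_zero hshift
    have hslide : Reduces (List.replicate M s ++ zigzag c₁ (ys.length + 1) ++ v)
        (zigzag c₁ (ys.length + 1) ++ List.replicate M s ++ v) :=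
      (reduces_dots_append_zigzag hc₁.ne_s M _).append_right v
    have hbetween := hdots.append_right (zigzag c₁ (ys.length + 1) ++ v)
    simp only [List.append_assoc] at hbelow hbetween hslide
    refine ⟨List.replicate M s ++ v, ?_⟩
    simpa [zigzag] using Reduces.append_left (u ++ [opp c₁])
      (((hbelow.append_left z).trans hbetween).trans hslide)

/-! ### Reductions to ambiguities -/

theorem allCross_of_reduces {j i : ℤ} {ys : List Word} {w : Word} (hys : ∀ y ∈ ys, Irr y)
    (h : Reduces ys.flatten w) (hw : ys.length ≤ crossings j i w) :
    AllCross j i ys ∧ crossings j i w = ys.length := by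
  have hle := crossings_flatten_le (j := j) (i := i) hys
  have hred := h.crossings_le j i
  rw [← crossings_flatten_eq_length_iff hys]
  omega

theorem Reduces.exists_crossing_of_zigzag {m n : ℕ} {i : ℤ} {y u v : Word} {ys : List Word}
    {c : Arrow} (hn : ys.length = n) (hys : ∀ x ∈ y :: ys, Irr x) (hc : c ≠ s)
    (hp : IsPath m i (u ++ zigzag c (n + 1) ++ v))
    (h : Reduces (y :: ys).flatten (u ++ zigzag c (n + 1) ++ v)) :
    ∃ j, AllCross j i (y :: ys) ∧ ∃ z, y = u ++ c :: z ∧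
      Crosses j (i + shift (z ++ ys.flatten)) [c] := by
  rw [List.append_assoc, zigzag, List.cons_append] at h hp
  obtain ⟨j, -, -, hj⟩ := ((isPath_append _ _ _ _).1 hp).1.exists_strand hc
  have hbelow := crossings_zigzag_append hj
  have htotal : crossings j i (u ++ c :: (zigzag (opp c) n ++ v)) =
      crossings j i v + n + 1 + crossings j (i + shift (c :: (zigzag (opp c) n ++ v))) u := by
    rw [crossings_append, crossings_cons_of_crosses hj, hbelow]
  obtain ⟨hall, hlen⟩ := allCross_of_reduces (j := j) hys h
    (by rw [htotal, List.length_cons]; omega)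
  have hlen_y := (crossings_flatten_eq_length_iff hys).2 hall
  rw [List.forall_mem_cons] at hys
  have hlen_ys := (crossings_flatten_eq_length_iff hys.2).2 (allCross_cons.1 hall).2
  obtain ⟨u₀, c₀, z, rfl, hc₀⟩ := hys.1.exists_crossing (allCross_cons.1 hall).1
  rw [List.length_cons] at hlen
  have hz := hys.1.crossings_append_eq hc₀
  rw [List.flatten_cons, List.append_assoc, List.cons_append] at h
  obtain ⟨rfl, d, hu⟩ := h.eq_of_crossings_eq hc₀ hj (by omega)
    (by rw [hlen, ← List.cons_append, ← List.append_assoc, ← List.flatten_cons, hlen_y,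
      List.length_cons])
  obtain rfl := hys.1.eq_of_reduces_append_dots hc hu
  exact ⟨j, hall, z, rfl, hc₀⟩

theorem Reduces.odd_crossings_iff {w w' : Word} (h : Reduces w w') (j a : ℤ) :
    Odd (crossings j a w) ↔ Odd (crossings j a w') := by
  rw [KLRW.odd_crossings_iff, KLRW.odd_crossings_iff, Crosses, Crosses, h.shift_eq]

theorem Reduces.crossings_ne_zero_of_dot {j i : ℤ} {y u v w : Word} {c : Arrow} (hy : Irr y)
    (h : Reduces (y ++ w) (u ++ s :: c :: v)) (hcy : Crosses j (i + shift w) y)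
    (hc : Crosses j (i + shift v) [c])
    (hw : crossings j i (u ++ s :: c :: v) = crossings j i (y ++ w)) :
    crossings j (i + shift (c :: v)) u ≠ 0 := by
  intro hu
  obtain ⟨u₀, c₀, z, rfl, hc₀⟩ := hy.exists_crossing hcy
  have hz := hy.crossings_append_eq hc₀
  have hbelow : crossings j i v = crossings j i (z ++ w) := by
    rw [crossings_append, crossings_append j i _ w, crossings_s_cons, shift_s_cons, hu,
      crossings_cons_of_crosses hc, hy.crossings_eq_one_iff.2 hcy] at hw
    omega
  have hu_eq : u ++ [s] = u₀ := by
    obtain ⟨-, d, hd⟩ := Reduces.eq_of_crossings_eq (u' := u ++ [s]) (by simpa using h) hc₀ hc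
      hbelow (by simpa using hw)
    exact hy.eq_of_reduces_append_dots hc₀.ne_s hd
  exact hy.s_notMem_left hc₀.ne_s (hu_eq ▸ by simp)

theorem allCross_of_reduces_s_zigzag {j i : ℤ} {y u v : Word} {ys : List Word} {c : Arrow}
    (hys : ∀ x ∈ y :: ys, Irr x) (h : Reduces (y :: ys).flatten (u ++ s :: c :: v))
    (hc : Crosses j (i + shift v) [c]) (hv : ys.length ≤ crossings j i v + 1) :
    AllCross j i ys ∧ crossings j i v + 1 = ys.length ∧
      crossings j i (u ++ s :: c :: v) = crossings j i (y :: ys).flatten := by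
  rw [List.forall_mem_cons] at hys
  rw [List.flatten_cons] at h ⊢
  have hys_le := crossings_flatten_le (j := j) (i := i) hys.2
  have hy_le := hys.1.crossings_le_one j (i + shift ys.flatten)
  have hsource := crossings_append j i y ys.flatten
  have htarget : crossings j i (u ++ s :: c :: v) =
      crossings j i v + 1 + crossings j (i + shift (c :: v)) u := by
    rw [crossings_append, crossings_s_cons, shift_s_cons, crossings_cons_of_crosses hc]
  have htotal : crossings j i (u ++ s :: c :: v) = crossings j i (y ++ ys.flatten) := by
    have hred := h.crossings_le j i
    have hparity := h.odd_crossings_iff j i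
    rw [Nat.odd_iff, Nat.odd_iff] at hparity
    omega
  rw [← crossings_flatten_eq_length_iff hys.2]
  by_cases hcross : Crosses j (i + shift ys.flatten) y
  · have hdot := Reduces.crossings_ne_zero_of_dot hys.1 h hcross hc htotal
    omega
  · rw [← hys.1.crossings_eq_one_iff] at hcross
    omega

theorem Reduces.exists_dots_of_s_zigzag {m n : ℕ} {i : ℤ} {y u v : Word} {ys : List Word}
    {c : Arrow} (hn : ys.length = n + 1) (hys : ∀ x ∈ y :: ys, Irr x) (hc : c ≠ s)
    (hp : IsPath m i (u ++ s :: zigzag c (n + 1) ++ v))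
    (h : Reduces (y :: ys).flatten (u ++ s :: zigzag c (n + 1) ++ v)) :
    ∃ j, AllCross j i ys ∧ ∃ y' y'' rest d, ys = (y' ++ c :: y'') :: rest ∧
      Crosses j (i + shift (y'' ++ rest.flatten)) [c] ∧
      Reduces (y ++ y') (u ++ List.replicate (d + 1) s) := by
  rw [List.append_assoc, zigzag, List.cons_append, List.cons_append] at h hp
  obtain ⟨j, -, -, hj⟩ :=
    ((isPath_append m i (u ++ [s]) _).1 (by simpa using hp)).1.exists_strand hc
  have hzigzag := crossings_zigzag_append hj
  obtain ⟨hall, hlen, htotal⟩ := allCross_of_reduces_s_zigzag hys h hj (by omega)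
  rcases ys with - | ⟨y₁, rest⟩
  · simp at hn
  rw [List.forall_mem_cons, List.forall_mem_cons] at hys
  obtain ⟨y', c₁, y'', rfl, hc₁⟩ := hys.2.1.exists_crossing (allCross_cons.1 hall).1
  have hrest := (crossings_flatten_eq_length_iff hys.2.2).2 (allCross_cons.1 hall).2
  have hbelow := hys.2.1.crossings_append_eq hc₁
  rw [List.length_cons] at hlen
  have hflatten : (y :: (y' ++ c₁ :: y'') :: rest).flatten =
      (y ++ y') ++ c₁ :: (y'' ++ rest.flatten) := by simp
  rw [hflatten] at h htotal
  obtain ⟨rfl, d, hd⟩ := Reduces.eq_of_crossings_eq (u := y ++ y') (u' := u ++ [s])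
    (by simpa using h) hc₁ hj (by omega) (by simpa using htotal)
  exact ⟨j, hall, y', y'', rest, d, rfl, hc₁, by simpa [List.replicate_succ] using hd⟩

theorem AllCross.reduces_s_zigzag {j i : ℤ} {y y' y'' u : Word} {rest : List Word} {c : Arrow}
    {d : ℕ} (h : AllCross j i ((y' ++ c :: y'') :: rest))
    (hys : ∀ x ∈ (y' ++ c :: y'') :: rest, Irr x)
    (hc : Crosses j (i + shift (y'' ++ rest.flatten)) [c])
    (hd : nf (y ++ y') = u ++ List.replicate (d + 1) s) :
    ∃ v, Reduces (y :: (y' ++ c :: y'') :: rest).flatten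
      (u ++ s :: zigzag c (rest.length + 1) ++ v) := by
  rw [List.forall_mem_cons] at hys
  obtain ⟨v, hv⟩ := (allCross_cons.1 h).2.reduces hys.2 hys.1 hc
  have htop := (Reduces.of_nf_eq hd).append_right (zigzag c (rest.length + 1) ++ v)
  have hslide := ((reduces_dots_append_zigzag hc.ne_s d (rest.length + 1)).append_right v)
  have hbelow := hv.append_left y
  refine ⟨List.replicate d s ++ v, ?_⟩
  simp only [List.append_assoc] at htop hslide hbelow
  simpa using (hbelow.trans htop).trans
    (by simpa [List.replicate_succ] using Reduces.append_left (u ++ [s]) hslide)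

theorem length_le_deg (w : Word) : w.length ≤ deg w := by
  induction w with
  | nil => exact Nat.zero_le _
  | cons x w ih =>
    rw [deg_cons, List.length_cons]
    cases x <;> simp only [deg_p, deg_q, deg_s] <;> omega

theorem eq_of_prefix_of_nf_eq {u v w : Word} (hu : u <+: w) (hv : v <+: w) (h : nf u = nf v) :
    u = v := by
  have hdeg := (nf_eq_nf_iff.1 h).2
  rcases List.prefix_or_prefix_of_prefix hu hv with ⟨z, rfl⟩ | ⟨z, rfl⟩ <;>
  · rw [deg_append] at hdeg
    have hz : z = [] := List.eq_nil_of_length_eq_zero (by have := length_le_deg z; omega)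
    rw [hz, List.append_nil]

theorem Irr.append_dots {w : Word} (h : Irr w) (n : ℕ) : Irr (w ++ List.replicate n s) := by
  obtain ⟨c, a, b, hc, rfl⟩ := h.exists_eq_replicate_append_dots
  rw [List.append_assoc, List.replicate_append_replicate]
  exact irr_replicate_append_dots hc _ _

theorem nf_append_dots (w : Word) (n : ℕ) :
    nf (w ++ List.replicate n s) = nf w ++ List.replicate n s := by
  rw [← ((irr_nf w).append_dots n).nf_eq, nf_nf_append]

/-! ### The terms of the splittings -/

section SplitTerms

variable {k : Type*} [Field k] {m n : ℕ}

theorem Gen.ext_of_nf {t t' : Gen m n} (hsrc : t.src = t'.src) (hleft : t.left = t'.left)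
    (hmid : t.mid = t'.mid)
    (hnf : nf (t.left ++ t.mid ++ t.right) = nf (t'.left ++ t'.mid ++ t'.right)) : t = t' := by
  refine Gen.ext hsrc hleft hmid ?_
  rw [← t.right_irr.nf_eq, ← t'.right_irr.nf_eq]
  simp only [nf_eq_nf_iff, shift_append, deg_append, hleft, hmid] at hnf ⊢
  omega

open Classical in
theorem tens_apply (n : ℕ) (a : ℤ) (u r v : Word) (t : Gen m n) :
    tens k m n a u r v t = if t.src = a ∧ nf u = t.left ∧ r = t.mid ∧ nf v = t.right ∧
      IsPath m a (u ++ r ++ v) then 1 else 0 := by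
  unfold tens
  split_ifs with hr ht ht
  · obtain ⟨hsrc, hleft, hmid, hright, -⟩ := ht
    rw [Finsupp.single_apply, if_pos (Gen.ext hsrc.symm hleft hmid hright)]
  · rw [Finsupp.single_apply, if_neg]
    rintro rfl
    exact ht ⟨rfl, rfl, rfl, rfl, hr.2⟩
  · obtain ⟨-, -, rfl, -, hp⟩ := ht
    exact absurd ⟨t.mid_amb, hp⟩ hr
  · rfl

open Classical in
theorem split_apply (n : ℕ) (a : ℤ) (w : Word) (t : Gen m n) :
    split k m n a w t = if t.src = a ∧ ∃ u v, w = u ++ t.mid ++ v ∧ nf u = t.left ∧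
      nf v = t.right ∧ IsPath m a w then 1 else 0 := by
  have hlen := t.mid_amb.1
  have hdec (l : ℕ) : w.take l ++ (w.drop l).take n ++ (w.drop l).drop n = w := by
    rw [List.append_assoc, List.take_append_drop, List.take_append_drop]
  rw [split, Finsupp.finsetSum_apply]
  simp only [tens_apply, hdec]
  split_ifs with h
  · obtain ⟨hsrc, u, v, rfl, hu, hv, hp⟩ := h
    rw [Finset.sum_eq_single u.length, if_pos]
    · exact ⟨hsrc, by simpa using hu, by simp [hlen], by simpa [hlen] using hv, hp⟩
    · intro l hl hne
      refine if_neg fun ⟨_, hleft, _⟩ => hne ?_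
      rw [← eq_of_prefix_of_nf_eq (List.take_prefix l _) ⟨t.mid ++ v, by simp⟩
        (hleft.trans hu.symm), List.length_take]
      rw [Finset.mem_range] at hl
      omega
    · simp
  · refine Finset.sum_eq_zero fun l _ => if_neg ?_
    rintro ⟨hsrc, hu, hmid, hv, hp⟩
    exact h ⟨hsrc, _, _, by rw [← hmid, hdec], hu, hv, hp⟩

theorem mem_splitTerms {i : ℤ} {w₀ : Word} {t : Gen m n} :
    t ∈ splitTerms k m n i w₀ ↔ t.src = i ∧ ∃ u v, Reduces w₀ (u ++ t.mid ++ v) ∧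
      IsPath m i (u ++ t.mid ++ v) ∧ nf u = t.left ∧ nf v = t.right := by
  classical
  simp only [splitTerms, Set.mem_ofPred_eq, Finsupp.mem_support_iff, split_apply, ne_eq,
    ite_eq_right_iff, one_ne_zero, imp_false, not_not]
  constructor
  · rintro ⟨_, hred, hsrc, u, v, rfl, hu, hv, hp⟩
    exact ⟨hsrc, u, v, hred, hp, hu, hv⟩
  · rintro ⟨hsrc, u, v, hred, hp, hu, hv⟩
    exact ⟨_, hred, hsrc, u, v, rfl, hu, hv, hp⟩

theorem nf_eq_of_mem_splitTerms {i : ℤ} {w₀ : Word} {t : Gen m n}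
    (h : t ∈ splitTerms k m n i w₀) : nf (t.left ++ t.mid ++ t.right) = nf w₀ := by
  obtain ⟨-, u, v, hred, -, hu, hv⟩ := mem_splitTerms.1 h
  rw [← hred.nf_eq, ← hu, ← hv]
  exact nf_append_congr (nf_append_congr (nf_nf u) rfl) (nf_nf v)

theorem finite_setOf_gen (n : ℕ) (i : ℤ) (w₀ : Word) :
    {t : Gen m n | t.src = i ∧ nf (t.left ++ t.mid ++ t.right) = nf w₀}.Finite := by
  have : Fintype Arrow := ⟨{p, q, s}, fun x => by cases x <;> simp⟩
  have hwords : {w : Word | w.length ≤ deg w₀}.Finite := List.finite_length_le Arrow (deg w₀)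
  refine Set.Finite.of_finite_image (f := fun t : Gen m n => (t.left, t.mid, t.right))
    ((hwords.prod (hwords.prod hwords)).subset ?_) ?_
  · rintro _ ⟨t, ⟨-, ht⟩, rfl⟩
    have hdeg := (nf_eq_nf_iff.1 ht).2
    rw [deg_append, deg_append] at hdeg
    have hleft := length_le_deg t.left
    have hmid := length_le_deg t.mid
    have hright := length_le_deg t.right
    refine ⟨?_, ?_, ?_⟩ <;> simp only [Set.mem_ofPred_eq] <;> omega
  · rintro t ⟨hsrc, -⟩ t' ⟨hsrc', -⟩ heq
    simp only [Prod.mk.injEq] at heq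
    exact Gen.ext (hsrc.trans hsrc'.symm) heq.1 heq.2.1 heq.2.2

theorem finite_splitTerms (n : ℕ) (i : ℤ) (w₀ : Word) : (splitTerms k m n i w₀).Finite :=
  (finite_setOf_gen n i w₀).subset fun _ h =>
    ⟨(mem_splitTerms.1 h).1, nf_eq_of_mem_splitTerms h⟩

theorem mem_splitTerms_of_reduces {i : ℤ} {w₀ v : Word} {t : Gen m n} (hp : IsPath m i w₀)
    (hsrc : t.src = i) (hnf : nf (t.left ++ t.mid ++ t.right) = nf w₀)
    (h : Reduces w₀ (t.left ++ t.mid ++ v)) : t ∈ splitTerms k m n i w₀ := by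
  refine mem_splitTerms.2 ⟨hsrc, t.left, v, h, reduces_isPath h hp, t.left_irr.nf_eq, ?_⟩
  rw [← t.right_irr.nf_eq]
  rw [← h.nf_eq] at hnf
  simp only [nf_eq_nf_iff, shift_append, deg_append] at hnf ⊢
  omega

theorem mem_splitTerms_iff_of_mid_eq_zigzag {i : ℤ} {y : Word} {ys : List Word} {c : Arrow}
    {t : Gen m (n + 1)} (hn : ys.length = n) (hys : ∀ x ∈ y :: ys, Irr x)
    (hp : IsPath m i (y :: ys).flatten) (hc : c ≠ s) (ht : t.mid = zigzag c (n + 1)) :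
    t ∈ splitTerms k m (n + 1) i (y :: ys).flatten ↔ t.src = i ∧
      nf (t.left ++ t.mid ++ t.right) = nf (y :: ys).flatten ∧
      ∃ j, AllCross j i (y :: ys) ∧ ∃ z, y = t.left ++ c :: z ∧
        Crosses j (i + shift (z ++ ys.flatten)) [c] := by
  constructor
  · intro hmem
    obtain ⟨hsrc, u, v, hred, hp', hu, -⟩ := mem_splitTerms.1 hmem
    rw [ht] at hred hp'
    obtain ⟨j, hall, z, rfl, hz⟩ := hred.exists_crossing_of_zigzag hn hys hc hp'
    rw [(List.forall_mem_cons.1 hys).1.of_append_left.nf_eq] at hu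
    exact ⟨hsrc, nf_eq_of_mem_splitTerms hmem, j, hall, z, by rw [hu], hz⟩
  · rintro ⟨hsrc, hnf, j, hall, z, rfl, hz⟩
    rw [List.forall_mem_cons] at hys
    obtain ⟨v, hv⟩ := (allCross_cons.1 hall).2.reduces hys.2 hys.1 hz
    rw [hn] at hv
    exact mem_splitTerms_of_reduces hp hsrc hnf (v := v) (by rwa [ht])

theorem mem_splitTerms_iff_of_mid_eq_s_zigzag {i : ℤ} {y : Word} {ys : List Word} {c : Arrow}
    {t : Gen m (n + 2)} (hn : ys.length = n + 1) (hys : ∀ x ∈ y :: ys, Irr x)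
    (hp : IsPath m i (y :: ys).flatten) (hc : c ≠ s) (ht : t.mid = s :: zigzag c (n + 1)) :
    t ∈ splitTerms k m (n + 2) i (y :: ys).flatten ↔ t.src = i ∧
      nf (t.left ++ t.mid ++ t.right) = nf (y :: ys).flatten ∧
      ∃ j, AllCross j i ys ∧ ∃ y' y'' rest, ys = (y' ++ c :: y'') :: rest ∧
        Crosses j (i + shift (y'' ++ rest.flatten)) [c] ∧
        ∃ d, nf (y ++ y') = t.left ++ List.replicate (d + 1) s := by
  constructor
  · intro hmem
    obtain ⟨hsrc, u, v, hred, hp', hu, -⟩ := mem_splitTerms.1 hmem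
    rw [ht] at hred hp'
    obtain ⟨j, hall, y', y'', rest, d, rfl, hcross, hd⟩ :=
      hred.exists_dots_of_s_zigzag hn hys hc hp'
    exact ⟨hsrc, nf_eq_of_mem_splitTerms hmem, j, hall, y', y'', rest, rfl, hcross, d, by
      rw [← hd.nf_eq, nf_append_dots, hu]⟩
  · rintro ⟨hsrc, hnf, j, hall, y', y'', rest, rfl, hcross, d, hd⟩
    obtain ⟨v, hv⟩ := hall.reduces_s_zigzag (List.forall_mem_cons.1 hys).2 hcross hd
    obtain rfl : rest.length = n := Nat.succ.inj hn
    exact mem_splitTerms_of_reduces hp hsrc hnf (v := v) (by rwa [ht])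

theorem splitTerms_eq_strandTerms {i : ℤ} {y : Word} {ys : List Word} (hn : ys.length = n + 1)
    (hys : ∀ x ∈ y :: ys, Irr x) (hp : IsPath m i (y :: ys).flatten) :
    splitTerms k m (n + 2) i (y :: ys).flatten = strandTerms m (n + 2) i y ys := by
  ext t
  simp only [strandTerms, Set.mem_ofPred_eq]
  constructor
  · intro ht
    obtain ⟨c, hc, hmid | hmid⟩ := t.mid_amb.eq_zigzag_or_eq_s_cons_zigzag
    · obtain ⟨hsrc, hnf, j, hall, z, rfl, hz⟩ :=
        (mem_splitTerms_iff_of_mid_eq_zigzag hn hys hp hc hmid).1 ht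
      obtain ⟨hj, hjm⟩ := hz.strand_bounds (m := m) (u := t.left) (by simpa using hp)
      rw [allCross_cons] at hall
      refine ⟨hsrc, hnf, j, hj, hjm, hall.2, ?_⟩
      rcases ys with - | ⟨y₁, rest⟩
      · simp at hn
      rw [List.forall_mem_cons, List.forall_mem_cons] at hys
      obtain ⟨y', c₁, y'', rfl, hc₁⟩ := hys.2.1.exists_crossing (allCross_cons.1 hall.2).1
      obtain ⟨rfl, -⟩ := eq_opp_of_crosses_of_crosses hys.2.1 hys.1 hc₁ hz
      exact ⟨y', c₁, y'', rest, rfl, hc₁, .inr ⟨hmid, z, rfl, hz⟩⟩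
    · obtain ⟨hsrc, hnf, j, hall, y', y'', rest, rfl, hcross, hd⟩ :=
        (mem_splitTerms_iff_of_mid_eq_s_zigzag hn hys hp hc hmid).1 ht
      obtain ⟨hj, hjm⟩ := hcross.strand_bounds (m := m) (u := y ++ y') (by simpa using hp)
      exact ⟨hsrc, hnf, j, hj, hjm, hall, y', c, y'', rest, rfl, hcross, .inl ⟨hmid, hd⟩⟩
  · rintro ⟨hsrc, hnf, j, -, -, hall, y', c, y'', rest, rfl, hcross, hterm⟩
    obtain ⟨hmid, hd⟩ | ⟨hmid, z, rfl, hz⟩ := hterm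
    · exact (mem_splitTerms_iff_of_mid_eq_s_zigzag hn hys hp hcross.ne_s hmid).2
        ⟨hsrc, hnf, j, hall, y', y'', rest, rfl, hcross, hd⟩
    · have htop := (List.forall_mem_cons.1 hys).1.crosses_of_crossing hz
      exact (mem_splitTerms_iff_of_mid_eq_zigzag hn hys hp (opp_ne_s hcross.ne_s) hmid).2
        ⟨hsrc, hnf, j, allCross_cons.2 ⟨htop, hall⟩, z, rfl, hz⟩

end SplitTerms

/-! ### The bimodule structure on pure tensors -/

section Bimodule

variable {k : Type*} [Field k] {m n n' : ℕ} {a : ℤ} {u r v : Word}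

theorem tens_eq_zero (h : ¬ (Amb n r ∧ IsPath m a (u ++ r ++ v))) : tens k m n a u r v = 0 :=
  dif_neg h

theorem tens_of_not_amb (h : ¬ Amb n r) : tens k m n a u r v = 0 :=
  tens_eq_zero fun h' => h h'.1

theorem tens_of_not_isPath (h : ¬ IsPath m a (u ++ r ++ v)) : tens k m n a u r v = 0 :=
  tens_eq_zero fun h' => h h'.2

theorem exists_tens_eq_single (h : Amb n r ∧ IsPath m a (u ++ r ++ v)) :
    ∃ t : Gen m n, tens k m n a u r v = Finsupp.single t 1 ∧ t.src = a ∧ t.left = nf u ∧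
      t.mid = r ∧ t.right = nf v :=
  ⟨_, dif_pos h, rfl, rfl, rfl, rfl⟩

theorem single_eq_tens (t : Gen m n) :
    Finsupp.single t (1 : k) = tens k m n t.src t.left t.mid t.right := by
  obtain ⟨t', htens, hsrc, hleft, hmid, hright⟩ :=
    exists_tens_eq_single (k := k) ⟨t.mid_amb, t.isPath⟩
  rw [htens, Gen.ext hsrc (hleft.trans t.left_irr.nf_eq) hmid (hright.trans t.right_irr.nf_eq)]

theorem linearMap_ext_tens {M : Type*} [AddCommMonoid M] [Module k M] {f g : P k m n →ₗ[k] M}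
    (h : ∀ t : Gen m n, f (tens k m n t.src t.left t.mid t.right) =
      g (tens k m n t.src t.left t.mid t.right)) : f = g :=
  Finsupp.lhom_ext' fun t => LinearMap.ext_ring <| by
    simpa only [LinearMap.comp_apply, Finsupp.lsingle_apply, single_eq_tens] using h t

theorem tens_congr {u' v' : Word}
    (hp : IsPath m a (u ++ r ++ v) ↔ IsPath m a (u' ++ r ++ v')) (hu : nf u = nf u')
    (hv : nf v = nf v') : tens k m n a u r v = tens k m n a u' r v' := by
  classical
  ext t
  rw [tens_apply, tens_apply, hu, hv, hp]

theorem isPath_nf_nf_iff (x : Word) (h : IsPath m a (u ++ r ++ v)) :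
    IsPath m a (x ++ nf u ++ r ++ nf v) ↔ IsPath m a (x ++ u ++ r ++ v) := by
  simp only [isPath_append, shift_nf] at h ⊢
  have hu := isPath_nf h.1
  have hv := isPath_nf h.2.2
  tauto

theorem tens_nf_nf (h : IsPath m a (u ++ r ++ v)) :
    tens k m n a (nf u) r (nf v) = tens k m n a u r v :=
  tens_congr (isPath_nf_nf_iff [] h) (nf_nf u) (nf_nf v)

theorem isPath_append_right_iff {b : ℤ} {y : Word} (hb : b + shift y = a)
    (h : IsPath m a (u ++ r ++ v)) :
    IsPath m b (nf u ++ r ++ (nf v ++ y)) ↔ IsPath m b (u ++ r ++ (v ++ y)) := by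
  subst hb
  simp only [isPath_append, shift_append, shift_nf] at h ⊢
  have hu := isPath_nf h.1
  have hv := isPath_nf h.2.2
  rw [show b + (shift v + shift y) = b + shift y + shift v by ring]
  tauto

theorem lact_tens (n : ℕ) (a b : ℤ) (x u r v : Word) :
    lact k m n b x (tens k m n a u r v) =
      if b = a + shift (u ++ r ++ v) then tens k m n a (x ++ u) r v else 0 := by
  by_cases h : Amb n r ∧ IsPath m a (u ++ r ++ v)
  · obtain ⟨t, htens, hsrc, hleft, hmid, hright⟩ := exists_tens_eq_single (k := k) h
    rw [htens, lact, Finsupp.linearCombination_single, one_smul, Gen.tgt, hsrc, hleft, hmid,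
      hright]
    simp only [shift_append, shift_nf]
    split_ifs
    · exact tens_congr (isPath_nf_nf_iff x h.2) (nf_append_congr rfl (nf_nf u)) (nf_nf v)
    · rfl
  · rw [tens_eq_zero h, map_zero, tens_eq_zero, ite_self]
    simp only [isPath_append] at h ⊢
    tauto

theorem ract_tens (n : ℕ) (a b : ℤ) (y u r v : Word) :
    ract k m n b y (tens k m n a u r v) =
      if b + shift y = a then tens k m n b u r (v ++ y) else 0 := by
  by_cases h : Amb n r ∧ IsPath m a (u ++ r ++ v)
  · obtain ⟨t, htens, hsrc, hleft, hmid, hright⟩ := exists_tens_eq_single (k := k) h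
    rw [htens, ract, Finsupp.linearCombination_single, one_smul, hsrc, hleft, hmid, hright]
    split_ifs with hb
    · exact tens_congr (isPath_append_right_iff hb h.2) (nf_nf u) (nf_append_congr (nf_nf v) rfl)
    · rfl
  · rw [tens_eq_zero h, map_zero]
    split_ifs with hb
    · subst hb
      rw [tens_eq_zero]
      simp only [isPath_append, shift_append] at h ⊢
      rw [show b + (shift v + shift y) = b + shift y + shift v by ring]
      tauto
    · rfl

theorem sandwich_tens (t : Gen m n) (h : shift (u ++ r ++ v) = shift t.mid) :
    sandwich k m n' t (tens k m n' (t.src + shift t.right) u r v) =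
      tens k m n' t.src (t.left ++ u) r (v ++ t.right) := by
  rw [sandwich, ract_tens, if_pos rfl, lact_tens, if_pos]
  simp only [shift_append] at h ⊢
  linarith

theorem sandwich_add (t : Gen m n) (f g : P k m n') :
    sandwich k m n' t (f + g) = sandwich k m n' t f + sandwich k m n' t g := by
  simp [sandwich]

theorem sandwich_sub (t : Gen m n) (f g : P k m n') :
    sandwich k m n' t (f - g) = sandwich k m n' t f - sandwich k m n' t g := by
  simp [sandwich]

theorem sandwich_smul (t : Gen m n) (c : k) (f : P k m n') :
    sandwich k m n' t (c • f) = c • sandwich k m n' t f := by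
  simp [sandwich]

end Bimodule

/-! ### The maps δ and γ -/

section DeltaGamma

variable {k : Type*} [Field k] {m n : ℕ}

theorem split_eq_add (a : ℤ) {w : Word} (h : Amb (n + 1) w) :
    split k m n a w = splitL k m n a w + splitR k m n a w := by
  have hlen := h.1
  rw [split, hlen, Finset.sum_range_succ', Finset.sum_range_succ', Finset.sum_eq_zero, zero_add,
    add_comm]
  · congr 1
    rw [splitR, List.take_of_length_le (l := w.drop 1) (by simp [hlen]),
      List.drop_eq_nil_of_le (as := w.drop 1) (by simp [hlen])]
  · intro l hl
    rw [Finset.mem_range] at hl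
    refine tens_of_not_amb fun h' => ?_
    have := h'.1
    rw [List.length_take, List.length_drop, hlen] at this
    omega

theorem delta_single (t : Gen m (n + 1)) :
    delta k m n (Finsupp.single t 1) =
      tens k m n t.src t.left (t.mid.take n) (t.mid.drop n ++ t.right) +
      (-1 : k) ^ (n + 1) • tens k m n t.src (t.left ++ t.mid.take 1) (t.mid.drop 1) t.right := by
  have uniform_sign : (if Even (n + 1) then split k m n (t.src + shift t.right) t.mid
      else splitL k m n (t.src + shift t.right) t.mid -
        splitR k m n (t.src + shift t.right) t.mid) =
      splitL k m n (t.src + shift t.right) t.mid +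
        (-1 : k) ^ (n + 1) • splitR k m n (t.src + shift t.right) t.mid := by
    split_ifs with he
    · rw [split_eq_add _ t.mid_amb, he.neg_one_pow, one_smul]
    · rw [(Nat.not_even_iff_odd.1 he).neg_one_pow, neg_one_smul, sub_eq_add_neg]
  rw [delta, Finsupp.linearCombination_single, one_smul, uniform_sign, sandwich_add,
    sandwich_smul, splitL, splitR, sandwich_tens, sandwich_tens, List.append_nil, List.nil_append]
  · rw [List.append_nil, List.take_append_drop]
  · rw [List.nil_append, List.take_append_drop]

theorem delta_tens (a : ℤ) (u : Word) {w : Word} (v : Word) (hw : Amb (n + 1) w) :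
    delta k m n (tens k m (n + 1) a u w v) = tens k m n a u (w.take n) (w.drop n ++ v) +
      (-1 : k) ^ (n + 1) • tens k m n a (u ++ w.take 1) (w.drop 1) v := by
  have splitL_path (u v : Word) : u ++ w.take n ++ (w.drop n ++ v) = u ++ w ++ v := by
    rw [List.append_assoc, ← List.append_assoc (w.take n), List.take_append_drop,
      List.append_assoc]
  have splitR_path (u v : Word) : u ++ w.take 1 ++ w.drop 1 ++ v = u ++ w ++ v := by
    rw [List.append_assoc u, List.take_append_drop]
  by_cases hp : IsPath m a (u ++ w ++ v)
  · have hnf : IsPath m a (nf u ++ w ++ nf v) ↔ IsPath m a (u ++ w ++ v) := isPath_nf_nf_iff [] hp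
    obtain ⟨t, htens, hsrc, hleft, hmid, hright⟩ := exists_tens_eq_single (k := k) ⟨hw, hp⟩
    rw [htens, delta_single, hsrc, hleft, hmid, hright]
    congr 1
    · exact tens_congr (by rw [splitL_path, splitL_path, hnf]) (nf_nf u)
        (nf_append_congr rfl (nf_nf v))
    · rw [tens_congr (by rw [splitR_path, splitR_path, hnf]) (nf_append_congr (nf_nf u) rfl)
        (nf_nf v)]
  · rw [tens_of_not_isPath hp, tens_of_not_isPath (by rwa [splitL_path]),
      tens_of_not_isPath (by rwa [splitR_path]), map_zero, smul_zero, add_zero]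

/-- The basis elements `u ⊗ r ⊗ v` such that no letter of `u` extends `r` to an ambiguity; these
span the image of `γ`, and `γ` vanishes on them. -/
def Tight (t : Gen m n) : Prop := ∀ u x, t.left = u ++ [x] → ¬ Amb (n + 1) (x :: t.mid)

variable (k m n) in
/-- The span of the tight basis elements. -/
def tightSpan : Submodule k (P k m n) := Finsupp.supported k k {t | Tight t}

theorem single_mem_tightSpan {t : Gen m n} (h : Tight t) :
    Finsupp.single t (1 : k) ∈ tightSpan k m n := Finsupp.single_mem_supported k 1 h

theorem tightSpan_le_comap {M : Type*} [AddCommMonoid M] [Module k M] {f : P k m n →ₗ[k] M}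
    {N : Submodule k M} (h : ∀ t, Tight t → f (Finsupp.single t 1) ∈ N) :
    tightSpan k m n ≤ N.comap f := by
  rw [tightSpan, Finsupp.supported_eq_span_single, Submodule.span_le]
  rintro _ ⟨t, ht, rfl⟩
  exact h t ht

theorem tens_mem_tightSpan {a : ℤ} {u r v : Word}
    (h : ∀ u' x, nf u = u' ++ [x] → ¬ Amb (n + 1) (x :: r)) :
    tens k m n a u r v ∈ tightSpan k m n := by
  by_cases hur : Amb n r ∧ IsPath m a (u ++ r ++ v)
  · obtain ⟨t, htens, -, hleft, hmid, -⟩ := exists_tens_eq_single (k := k) hur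
    rw [htens]
    refine single_mem_tightSpan fun u' x hu' => ?_
    rw [hmid]
    exact h u' x (hleft ▸ hu')
  · rw [tens_eq_zero hur]
    exact zero_mem _

theorem tens_nil_mem_tightSpan (a : ℤ) (r v : Word) :
    tens k m n a [] r v ∈ tightSpan k m n :=
  tens_mem_tightSpan fun _ _ h => by simp [irr_nil.nf_eq] at h

theorem tens_s_mem_tightSpan (a : ℤ) (u r v : Word) :
    tens k m n a u (s :: r) v ∈ tightSpan k m n :=
  tens_mem_tightSpan fun _ _ _ h => (inS_iff.1 (List.isChain_cons_cons.1 h.2).1).1 rfl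

theorem tens_irr_mem_tightSpan (a : ℤ) {u r v : Word} {x : Arrow} (h : Irr (u ++ [x])) :
    tens k m n a u (x :: r) v ∈ tightSpan k m n := by
  refine tens_mem_tightSpan fun u' y hu' hyx => ?_
  rw [h.of_append_left.nf_eq] at hu'
  subst hu'
  exact h _ (List.isChain_cons_cons.1 hyx.2).1 ⟨u', [], by simp⟩

theorem lact_nil_mem_tightSpan (a : ℤ) {f : P k m n} (hf : f ∈ tightSpan k m n) :
    lact k m n a [] f ∈ tightSpan k m n := by
  refine tightSpan_le_comap (N := tightSpan k m n) (f := lact k m n a []) (fun t ht => ?_) hf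
  rw [single_eq_tens, lact_tens]
  split_ifs
  · rw [List.nil_append, ← single_eq_tens]
    exact single_mem_tightSpan ht
  · exact zero_mem _

theorem ract_mem_tightSpan (a : ℤ) (y : Word) {f : P k m n} (hf : f ∈ tightSpan k m n) :
    ract k m n a y f ∈ tightSpan k m n := by
  refine tightSpan_le_comap (N := tightSpan k m n) (f := ract k m n a y) (fun t ht => ?_) hf
  rw [single_eq_tens, ract_tens]
  split_ifs
  · refine tens_mem_tightSpan fun u x hu => ht u x ?_
    rwa [t.left_irr.nf_eq] at hu
  · exact zero_mem _

theorem gamma_single (t : Gen m n) :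
    gamma k m n (Finsupp.single t 1) = (-1 : k) ^ (n + 1) •
      ∑ l ∈ Finset.range ((t.left ++ t.mid).length + 1),
        tens k m (n + 1) t.src ((t.left ++ t.mid).take l)
          (((t.left ++ t.mid).drop l).take (n + 1))
          (((t.left ++ t.mid).drop l).drop (n + 1) ++ t.right) := by
  rw [gamma, Finsupp.linearCombination_single, one_smul, split, map_sum]
  simp only [ract_tens, if_true]

theorem not_amb_take_of_irr {l : ℕ} {u w : Word} (hu : Irr u) (hl : l + 2 ≤ u.length) :
    ¬ Amb (n + 2) (((u ++ w).drop l).take (n + 2)) := by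
  intro h
  obtain ⟨y, z, v, hdrop⟩ : ∃ y z v, u.drop l = y :: z :: v :=
    ⟨_, _, _, by rw [List.drop_eq_getElem_cons (by omega), List.drop_eq_getElem_cons (by omega)]⟩
  rw [List.drop_append_of_le_length (by omega), hdrop] at h
  have hyz : InS [y, z] := (List.isChain_cons_cons.1 h.2).1
  exact hu _ hyz ⟨u.take l, v, by simpa [hdrop] using List.take_append_drop l u⟩

theorem gamma_single_of_left_eq {t : Gen m (n + 1)} {u : Word} {x : Arrow}
    (h : t.left = u ++ [x]) :
    gamma k m (n + 1) (Finsupp.single t 1) =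
      (-1 : k) ^ (n + 2) • tens k m (n + 2) t.src u (x :: t.mid) t.right := by
  have hlen := t.mid_amb.1
  rw [gamma_single, Finset.sum_eq_single u.length]
  · simp [h, List.take_of_length_le hlen.le, List.drop_eq_nil_of_le hlen.le]
  · intro l _ hl
    refine tens_of_not_amb fun ha => ?_
    have hla := ha.1
    simp only [List.length_take, List.length_drop, List.length_append, hlen, h,
      List.length_singleton] at hla
    refine not_amb_take_of_irr t.left_irr ?_ ha
    rw [h, List.length_append, List.length_singleton]
    omega
  · intro hu
    simp [h] at hu

theorem gamma_single_of_left_nil {t : Gen m n} (h : t.left = []) :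
    gamma k m n (Finsupp.single t 1) = 0 := by
  rw [gamma_single, Finset.sum_eq_zero, smul_zero]
  intro l _
  refine tens_of_not_amb fun ha => ?_
  have hla := ha.1
  rw [List.length_take, List.length_drop, List.length_append, t.mid_amb.1, h,
    List.length_nil] at hla
  omega

theorem gamma_apply_tight {f : P k m n} (hf : f ∈ tightSpan k m n) : gamma k m n f = 0 := by
  refine tightSpan_le_comap (N := ⊥) (fun t ht => ?_) hf
  rw [Submodule.mem_bot]
  rcases List.eq_nil_or_concat' t.left with h | ⟨u, x, h⟩
  · exact gamma_single_of_left_nil h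
  · cases n with
    | zero =>
      have hx := ht u x h
      rw [List.eq_nil_of_length_eq_zero t.mid_amb.1] at hx
      exact absurd (amb_singleton x) hx
    | succ n => rw [gamma_single_of_left_eq h, tens_of_not_amb (ht u x h), smul_zero]

theorem gamma_zero_single (t : Gen m 0) :
    gamma k m 0 (Finsupp.single t 1) = - ract k m 1 t.src t.right
      (split k m 1 (t.src + shift t.right) t.left) := by
  rw [gamma, Finsupp.linearCombination_single, one_smul,
    List.eq_nil_of_length_eq_zero t.mid_amb.1, List.append_nil]
  simp

theorem split_one_mem_tightSpan (a : ℤ) {w : Word} (hw : Irr w) :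
    split k m 1 a w ∈ tightSpan k m 1 := by
  refine Submodule.sum_mem _ fun l _ => ?_
  rcases hdrop : w.drop l with - | ⟨x, v⟩
  · rw [tens_of_not_amb (by simp [Amb])]
    exact zero_mem _
  · have hw' := List.take_append_drop l w
    rw [hdrop] at hw'
    exact tens_irr_mem_tightSpan a (hw.of_infix ⟨[], v, by simpa using hw'⟩)

theorem gamma_mem_tightSpan (f : P k m n) : gamma k m n f ∈ tightSpan k m (n + 1) := by
  induction f using Finsupp.induction_linear with
  | zero => rw [map_zero]; exact zero_mem _
  | add f g hf hg => rw [map_add]; exact add_mem hf hg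
  | single t c =>
    rw [← mul_one c, ← smul_eq_mul, ← Finsupp.smul_single, map_smul]
    refine Submodule.smul_mem _ _ ?_
    cases n with
    | zero =>
      rw [gamma_zero_single]
      exact Submodule.neg_mem _ (ract_mem_tightSpan _ _ (split_one_mem_tightSpan _ t.left_irr))
    | succ n =>
      rcases List.eq_nil_or_concat' t.left with h | ⟨u, x, h⟩
      · rw [gamma_single_of_left_nil h]
        exact zero_mem _
      · rw [gamma_single_of_left_eq h]
        exact Submodule.smul_mem _ _ (tens_irr_mem_tightSpan _ (h ▸ t.left_irr))

end DeltaGamma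

/-! ### The correction terms of ρ -/

section Err

variable {k : Type*} [Field k] {m n : ℕ}

variable (k m n) in
/-- The difference `δ_{n+1} - ∂_{n+1}`, whose powers `(err ∘ γ)^i` make up `ρ_n`. -/
noncomputable def err : P k m (n + 1) →ₗ[k] P k m n := delta k m n - diff k m n

variable (k m n) in
/-- The value of `err` on `u ⊗ w ⊗ v`, see `errFormula`. An ambiguity starting with a dot loses this
dot to its lower end and slides either up past its next letter or down through all of them; in an
ambiguity starting with a crossing the first two crossings straighten to a dot. -/
noncomputable def errTerm (a : ℤ) (u : Word) : Word → Word → P k m n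
  | x :: y :: r, v => (-1 : k) ^ (n + 1) •
      if x = s then tens k m n a (u ++ [y]) (s :: r) v + tens k m n a u (y :: r) (s :: v)
      else tens k m n a u (s :: r) v
  | _, _ => 0

variable (k m n) in
/-- The formula `errTerm` for `err` in degree `n + 1`, as a predicate for the induction on `n`. -/
def ErrFormula : Prop := ∀ t : Gen m (n + 1),
  err k m n (Finsupp.single t 1) = errTerm k m n t.src t.left t.mid t.right

theorem rhoSummand_diff (t : Gen m n) (i : ℕ) :
    rhoSummand k m n (diff k m n) t i =
      gamma k m n (((err k m n ∘ₗ gamma k m n) ^ i) (Finsupp.single t 1)) := by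
  rw [rhoSummand, err, LinearMap.sub_comp]

theorem rho_eq_rhoOf (n : ℕ) : rho k m n = rhoOf k m n (diff k m n) := by
  cases n <;> rfl

theorem rho_single (t : Gen m n) :
    rho k m n (Finsupp.single t 1) = ∑ᶠ i, rhoSummand k m n (diff k m n) t i := by
  rw [rho_eq_rhoOf, rhoOf, Finsupp.linearCombination_single, one_smul]

theorem gamma_err_pow_tight {f : P k m n} (hf : f ∈ tightSpan k m n) (i : ℕ) :
    gamma k m n (((err k m n ∘ₗ gamma k m n) ^ i) f) = 0 := by
  cases i with
  | zero => exact gamma_apply_tight hf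
  | succ i => simp [pow_succ, gamma_apply_tight hf]

theorem rhoSummand_of_tight {t : Gen m n} (ht : Tight t) (i : ℕ) :
    rhoSummand k m n (diff k m n) t i = 0 := by
  rw [rhoSummand_diff, gamma_err_pow_tight (single_mem_tightSpan ht)]

theorem rhoSummand_succ {t : Gen m n} {f : P k m n}
    (h : err k m n (gamma k m n (Finsupp.single t 1)) - f ∈ tightSpan k m n) (i : ℕ) :
    rhoSummand k m n (diff k m n) t (i + 1) =
      gamma k m n (((err k m n ∘ₗ gamma k m n) ^ i) f) := by
  have := gamma_err_pow_tight h i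
  rw [map_sub, map_sub, sub_eq_zero] at this
  rw [rhoSummand_diff, pow_succ, ← this]
  rfl

theorem rho_apply_tight {f : P k m n} (hf : f ∈ tightSpan k m n) : rho k m n f = 0 := by
  refine tightSpan_le_comap (N := ⊥) (fun t ht => ?_) hf
  rw [Submodule.mem_bot, rho_single]
  simp only [rhoSummand_of_tight ht, finsum_zero]

theorem rho_mem_tightSpan (f : P k m n) : rho k m n f ∈ tightSpan k m (n + 1) := by
  induction f using Finsupp.induction_linear with
  | zero => rw [map_zero]; exact zero_mem _
  | add f g hf hg => rw [map_add]; exact add_mem hf hg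
  | single t c =>
    rw [← mul_one c, ← smul_eq_mul, ← Finsupp.smul_single, map_smul, rho_single]
    refine Submodule.smul_mem _ _ <| finsum_induction (· ∈ tightSpan k m (n + 1)) (zero_mem _)
      (fun _ _ => add_mem) fun i => ?_
    rw [rhoSummand_diff]
    exact gamma_mem_tightSpan _

theorem finsum_nat_eq_add {M : Type*} [AddCommMonoid M] {f : ℕ → M}
    (h : (Function.support f).Finite) : ∑ᶠ i, f i = f 0 + ∑ᶠ i, f (i + 1) := by
  obtain ⟨N, hN⟩ := h.bddAbove
  have support_f : Function.support f ⊆ ↑(Finset.range (N + 2)) := fun i hi =>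
    Finset.mem_coe.2 (Finset.mem_range.2 (by have := hN hi; omega))
  have support_succ : Function.support (fun i => f (i + 1)) ⊆ ↑(Finset.range (N + 1)) :=
    fun i hi => Finset.mem_coe.2 (Finset.mem_range.2 (by have := hN hi; omega))
  rw [finsum_eq_sum_of_support_subset _ support_f, finsum_eq_sum_of_support_subset _ support_succ,
    Finset.sum_range_succ', add_comm]

theorem isPath_s_cons {a : ℤ} {w : Word} : IsPath m a (s :: w) ↔ IsPath m a w := by
  rw [isPath_cons, shift_cons, shift_s, zero_add]
  exact ⟨fun h => h.1, fun h => ⟨h, h w List.suffix_rfl⟩⟩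

theorem isPath_slide_iff {a : ℤ} {u r v : Word} :
    IsPath m a (u ++ r ++ s :: v) ↔ IsPath m a (u ++ [s] ++ r ++ v) := by
  simp only [isPath_append, shift_cons s v, isPath_s_cons, shift_s, isPath_nil, zero_add,
    add_zero, and_congr_right_iff]
  intro _ hr
  exact (and_iff_right (hr _ List.suffix_rfl)).symm

theorem nf_append_s (w : Word) : nf (w ++ [s]) = nf w ++ [s] := nf_append_dots w 1

namespace ErrFormula

theorem err_tens (hE : ErrFormula k m n) {a : ℤ} {u w v : Word} (hw : Amb (n + 1) w)
    (hp : IsPath m a (u ++ w ++ v)) :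
    err k m n (tens k m (n + 1) a u w v) = errTerm k m n a (nf u) w (nf v) := by
  obtain ⟨t, htens, hsrc, hleft, hmid, hright⟩ := exists_tens_eq_single (k := k) ⟨hw, hp⟩
  rw [htens, hE, hsrc, hleft, hmid, hright]

theorem err_tens_mem_tightSpan (hE : ErrFormula k m n) {a : ℤ} {u w v : Word}
    (h : errTerm k m n a (nf u) w (nf v) ∈ tightSpan k m n) :
    err k m n (tens k m (n + 1) a u w v) ∈ tightSpan k m n := by
  by_cases hw : Amb (n + 1) w ∧ IsPath m a (u ++ w ++ v)
  · rwa [hE.err_tens hw.1 hw.2]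
  · rw [tens_eq_zero hw, map_zero]
    exact zero_mem _

theorem err_tens_nil_mem_tightSpan (hE : ErrFormula k m n) (a : ℤ) (w v : Word) :
    err k m n (tens k m (n + 1) a [] w v) ∈ tightSpan k m n := by
  refine hE.err_tens_mem_tightSpan ?_
  rw [irr_nil.nf_eq]
  rcases w with - | ⟨x, - | ⟨y, r⟩⟩
  · exact zero_mem _
  · exact zero_mem _
  · refine Submodule.smul_mem _ _ ?_
    split_ifs
    · exact add_mem (tens_s_mem_tightSpan _ _ _ _) (tens_nil_mem_tightSpan _ _ _)
    · exact tens_s_mem_tightSpan _ _ _ _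

theorem err_tens_cons_mem_tightSpan (hE : ErrFormula k m n) (a : ℤ) (u w v : Word) {x : Arrow}
    (hx : x ≠ s) : err k m n (tens k m (n + 1) a u (x :: w) v) ∈ tightSpan k m n := by
  refine hE.err_tens_mem_tightSpan ?_
  rcases w with - | ⟨y, r⟩
  · exact zero_mem _
  · rw [errTerm, if_neg hx]
    exact Submodule.smul_mem _ _ (tens_s_mem_tightSpan _ _ _ _)

theorem err_gamma_dot (hE : ErrFormula k m (n + 1)) {t : Gen m (n + 1)} {u r : Word} {c : Arrow}
    (hc : c ≠ s) (hleft : t.left = u ++ [s]) (hmid : t.mid = c :: r) :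
    err k m (n + 1) (gamma k m (n + 1) (Finsupp.single t 1)) -
      tens k m (n + 1) t.src u t.mid (s :: t.right) ∈ tightSpan k m (n + 1) := by
  have hp := t.isPath
  have hu : Irr u := (hleft ▸ t.left_irr).of_append_left
  have ha : Amb (n + 2) (s :: t.mid) := by
    rw [hmid, amb_cons_cons, ← hmid]
    exact ⟨inS_s hc, t.mid_amb⟩
  rw [gamma_single_of_left_eq hleft, map_smul, hE.err_tens ha (by simpa [hleft] using hp),
    hu.nf_eq, t.right_irr.nf_eq, hmid, errTerm, if_pos rfl, smul_smul, ← mul_pow, neg_mul_neg,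
    mul_one, one_pow, one_smul, add_sub_cancel_right]
  exact tens_s_mem_tightSpan _ _ _ _

theorem err_gamma_arrow (hE : ErrFormula k m (n + 1)) {t : Gen m (n + 1)} {u : Word} {x : Arrow}
    (hx : x ≠ s) (hleft : t.left = u ++ [x]) :
    err k m (n + 1) (gamma k m (n + 1) (Finsupp.single t 1)) ∈ tightSpan k m (n + 1) := by
  rw [gamma_single_of_left_eq hleft, map_smul]
  exact Submodule.smul_mem _ _ (hE.err_tens_cons_mem_tightSpan _ _ _ _ hx)

end ErrFormula

theorem Gen.mid_eq_cons (t : Gen m (n + 1)) : ∃ c r, t.mid = c :: r :=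
  List.exists_cons_of_length_eq_add_one t.mid_amb.1

theorem tight_of_mid_eq_s_cons {t : Gen m n} {r : Word} (h : t.mid = s :: r) : Tight t := by
  intro u x _ ha
  rw [h] at ha
  exact (inS_iff.1 (List.isChain_cons_cons.1 ha.2).1).1 rfl

theorem tight_of_left_eq_nil {t : Gen m n} (h : t.left = []) : Tight t :=
  fun u x hu => by simp [h] at hu

theorem exists_dropped_dot {t : Gen m n} {u : Word} (hleft : t.left = u ++ [s]) :
    ∃ t' : Gen m n, tens k m n t.src u t.mid (s :: t.right) = Finsupp.single t' 1 ∧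
      t'.left = u := by
  have hp : IsPath m t.src (u ++ t.mid ++ s :: t.right) := by
    rw [isPath_slide_iff, ← hleft]
    exact t.isPath
  obtain ⟨t', htens, -, hleft', -, -⟩ := exists_tens_eq_single (k := k) ⟨t.mid_amb, hp⟩
  exact ⟨t', htens, hleft'.trans (hleft ▸ t.left_irr).of_append_left.nf_eq⟩

namespace ErrFormula

theorem exists_rhoSummand_eq_zero (hE : ErrFormula k m (n + 1)) (t : Gen m (n + 1)) :
    ∃ N, ∀ i, N ≤ i → rhoSummand k m (n + 1) (diff k m (n + 1)) t i = 0 := by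
  obtain ⟨c, r, hmid⟩ := t.mid_eq_cons
  by_cases hc : c = s
  · exact ⟨0, fun i _ => rhoSummand_of_tight (tight_of_mid_eq_s_cons (hc ▸ hmid)) i⟩
  rcases List.eq_nil_or_concat' t.left with hleft | ⟨u, x, hleft⟩
  · exact ⟨0, fun i _ => rhoSummand_of_tight (tight_of_left_eq_nil hleft) i⟩
  by_cases hx : x = s
  · subst hx
    obtain ⟨t', htens, hleft'⟩ := exists_dropped_dot (k := k) hleft
    have : t'.left.length < t.left.length := by simp [hleft, hleft']
    obtain ⟨N, hN⟩ := exists_rhoSummand_eq_zero hE t'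
    refine ⟨N + 1, fun i hi => ?_⟩
    obtain ⟨i, rfl⟩ := Nat.exists_eq_add_of_le' (Nat.one_le_of_lt hi)
    rw [rhoSummand_succ (htens ▸ hE.err_gamma_dot hc hleft hmid), ← rhoSummand_diff]
    exact hN i (Nat.le_of_succ_le_succ hi)
  · refine ⟨1, fun i hi => ?_⟩
    obtain ⟨i, rfl⟩ := Nat.exists_eq_add_of_le' hi
    rw [rhoSummand_succ (f := 0) (by simpa using hE.err_gamma_arrow hx hleft), map_zero, map_zero]
termination_by t.left.length

theorem finite_support_rhoSummand (hE : ErrFormula k m (n + 1)) (t : Gen m (n + 1)) :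
    (Function.support (rhoSummand k m (n + 1) (diff k m (n + 1)) t)).Finite := by
  obtain ⟨N, hN⟩ := hE.exists_rhoSummand_eq_zero t
  exact (Set.finite_Iio N).subset fun i hi => not_le.1 fun h => hi (hN i h)

theorem rho_single_eq_add (hE : ErrFormula k m (n + 1)) {t : Gen m (n + 1)} {u : Word} {x : Arrow}
    (hleft : t.left = u ++ [x]) :
    rho k m (n + 1) (Finsupp.single t 1) =
      (-1 : k) ^ (n + 2) • tens k m (n + 2) t.src u (x :: t.mid) t.right +
        ∑ᶠ i, rhoSummand k m (n + 1) (diff k m (n + 1)) t (i + 1) := by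
  rw [rho_single, finsum_nat_eq_add (hE.finite_support_rhoSummand t), rhoSummand_diff, pow_zero,
    Module.End.one_apply, gamma_single_of_left_eq hleft]

theorem rho_single_dot (hE : ErrFormula k m (n + 1)) {t : Gen m (n + 1)} {u r : Word} {c : Arrow}
    (hc : c ≠ s) (hleft : t.left = u ++ [s]) (hmid : t.mid = c :: r) :
    rho k m (n + 1) (Finsupp.single t 1) =
      (-1 : k) ^ (n + 2) • tens k m (n + 2) t.src u (s :: t.mid) t.right +
        rho k m (n + 1) (tens k m (n + 1) t.src u t.mid (s :: t.right)) := by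
  obtain ⟨t', htens, -⟩ := exists_dropped_dot (k := k) hleft
  rw [hE.rho_single_eq_add hleft, htens, rho_single t']
  congr 1
  exact finsum_congr fun i => by
    rw [rhoSummand_succ (htens ▸ hE.err_gamma_dot hc hleft hmid), ← rhoSummand_diff]

theorem rho_single_arrow (hE : ErrFormula k m (n + 1)) {t : Gen m (n + 1)} {u : Word} {x : Arrow}
    (hx : x ≠ s) (hleft : t.left = u ++ [x]) :
    rho k m (n + 1) (Finsupp.single t 1) =
      (-1 : k) ^ (n + 2) • tens k m (n + 2) t.src u (x :: t.mid) t.right := by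
  rw [hE.rho_single_eq_add hleft, finsum_eq_zero_of_forall_eq_zero, add_zero]
  intro i
  rw [rhoSummand_succ (f := 0) (by simpa using hE.err_gamma_arrow hx hleft), map_zero, map_zero]

theorem rho_dot (hE : ErrFormula k m (n + 1)) {a : ℤ} {u r v : Word} {c : Arrow} (hc : c ≠ s) :
    rho k m (n + 1) (tens k m (n + 1) a (u ++ [s]) (c :: r) v) =
      (-1 : k) ^ (n + 2) • tens k m (n + 2) a u (s :: c :: r) v +
        rho k m (n + 1) (tens k m (n + 1) a u (c :: r) (s :: v)) := by
  by_cases h : Amb (n + 1) (c :: r) ∧ IsPath m a (u ++ [s] ++ c :: r ++ v)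
  · obtain ⟨t, htens, hsrc, hleft, hmid, hright⟩ := exists_tens_eq_single (k := k) h
    rw [nf_append_s] at hleft
    have hp : IsPath m a (u ++ s :: c :: r ++ v) := by simpa using h.2
    have hp' : IsPath m a (nf u ++ c :: r ++ s :: nf v) := by
      rw [isPath_slide_iff, ← nf_append_s]
      exact (isPath_nf_nf_iff [] h.2).2 h.2
    rw [htens, hE.rho_single_dot hc hleft hmid, hsrc, hmid, hright, tens_nf_nf hp,
      tens_congr (iff_of_true hp' (isPath_slide_iff.2 h.2)) (nf_nf u)
        (nf_append_congr (u := [s]) rfl (nf_nf v))]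
  · rw [tens_eq_zero h, tens_eq_zero (mt _ h), tens_eq_zero (mt _ h)]
    · simp
    · exact fun h' => ⟨h'.1, isPath_slide_iff.1 h'.2⟩
    · exact fun h' => ⟨h'.1.tail, by simpa using h'.2⟩

theorem rho_arrow (hE : ErrFormula k m (n + 1)) {a : ℤ} {u r v : Word} {x : Arrow} (hx : x ≠ s)
    (hu : Irr (u ++ [x])) :
    rho k m (n + 1) (tens k m (n + 1) a (u ++ [x]) r v) =
      (-1 : k) ^ (n + 2) • tens k m (n + 2) a u (x :: r) v := by
  by_cases h : Amb (n + 1) r ∧ IsPath m a (u ++ [x] ++ r ++ v)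
  · obtain ⟨t, htens, hsrc, hleft, hmid, hright⟩ := exists_tens_eq_single (k := k) h
    have hp : IsPath m a (u ++ x :: r ++ v) := by simpa using h.2
    rw [htens, hE.rho_single_arrow hx (hleft.trans hu.nf_eq), hsrc, hmid, hright, ← tens_nf_nf hp,
      hu.of_append_left.nf_eq]
  · rw [tens_eq_zero h, tens_eq_zero (mt _ h), map_zero, smul_zero]
    exact fun h' => ⟨h'.1.tail, by simpa using h'.2⟩

end ErrFormula

end Err

/-! ### The differential -/

section Differential

variable {k : Type*} [Field k] {m n : ℕ}

theorem delta_single_eq_sandwich (t : Gen m (n + 1)) :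
    delta k m n (Finsupp.single t 1) = sandwich k m n t (delta k m n (core k m t)) := by
  rw [delta_single, core, delta_tens _ _ _ t.mid_amb, sandwich_add, sandwich_smul, sandwich_tens,
    sandwich_tens]
  · simp
  · rw [List.nil_append, List.append_nil, List.take_append_drop]
  · rw [List.nil_append, List.append_nil, List.take_append_drop]

theorem partialZero_tens (a : ℤ) (u v : Word) :
    partialZero k m (tens k m 0 a u [] v) = proj k m a (u ++ v) := by
  by_cases hp : IsPath m a (u ++ v)
  · obtain ⟨t, htens, hsrc, hleft, -, hright⟩ :=
      exists_tens_eq_single (k := k) (v := v) ⟨amb_nil, by rwa [List.append_nil u]⟩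
    rw [htens, partialZero, Finsupp.linearCombination_single, one_smul, hsrc, hleft, hright, proj,
      proj, dif_pos (isPath_nf_append hp), dif_pos hp]
    congr 1
    exact IrrPath.ext rfl (nf_append_congr (nf_nf u) (nf_nf v))
  · rw [tens_of_not_isPath (by rwa [List.append_nil]), map_zero, proj, dif_neg hp]

theorem diff_zero_single (t : Gen m 1) :
    diff k m 0 (Finsupp.single t 1) = sandwich k m 0 t (delta k m 0 (core k m t) -
      rhoNegOne k m (partialZero k m (delta k m 0 (core k m t)))) := by
  rw [diff, resolution, Finsupp.linearCombination_single, one_smul]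

theorem diff_succ_single (t : Gen m (n + 2)) :
    diff k m (n + 1) (Finsupp.single t 1) = sandwich k m (n + 1) t
      (delta k m (n + 1) (core k m t) -
        rho k m n (diff k m n (delta k m (n + 1) (core k m t)))) := by
  rw [diff, resolution, Finsupp.linearCombination_single, one_smul]
  rfl

theorem errTerm_zero (t : Gen m 1) : errTerm k m 0 t.src t.left t.mid t.right = 0 := by
  obtain ⟨x, hmid⟩ := List.length_eq_one_iff.1 t.mid_amb.1
  rw [hmid, errTerm]
  simp

theorem errFormula_zero : ErrFormula k m 0 := by
  intro t
  have partialZero_delta : partialZero k m (delta k m 0 (core k m t)) = 0 := by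
    rw [core, delta_tens _ _ _ t.mid_amb, List.drop_eq_nil_of_le t.mid_amb.1.le,
      List.take_of_length_le t.mid_amb.1.le, List.take_zero, map_add, map_smul, partialZero_tens,
      partialZero_tens]
    simp
  rw [errTerm_zero, err, LinearMap.sub_apply, sub_eq_zero, delta_single_eq_sandwich,
    diff_zero_single, partialZero_delta, map_zero, sub_zero]

theorem err_zero : err k m 0 = 0 :=
  Finsupp.lhom_ext' fun t => LinearMap.ext_ring ((errFormula_zero t).trans (errTerm_zero t))

theorem err_succ_single (t : Gen m (n + 2)) :
    err k m (n + 1) (Finsupp.single t 1) = sandwich k m (n + 1) t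
      (rho k m n (diff k m n (delta k m (n + 1) (core k m t)))) := by
  rw [err, LinearMap.sub_apply, delta_single_eq_sandwich, diff_succ_single, sandwich_sub,
    sub_sub_cancel]

theorem rhoSummand_zero_succ (t : Gen m 0) (i : ℕ) :
    rhoSummand k m 0 (diff k m 0) t (i + 1) = 0 := by
  rw [rhoSummand_diff, err_zero, LinearMap.zero_comp, zero_pow i.succ_ne_zero,
    LinearMap.zero_apply, map_zero]

theorem rho_zero_eq_gamma : rho k m 0 = gamma k m 0 := by
  refine Finsupp.lhom_ext' fun t => LinearMap.ext_ring ?_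
  simp only [LinearMap.comp_apply, Finsupp.lsingle_apply]
  rw [rho_single, finsum_eq_single _ 0, rhoSummand_diff, pow_zero, Module.End.one_apply]
  intro i hi
  obtain ⟨i, rfl⟩ := Nat.exists_eq_succ_of_ne_zero hi
  exact rhoSummand_zero_succ t i

theorem gamma_zero_tens (a : ℤ) {u : Word} (v : Word) (hu : Irr u) :
    gamma k m 0 (tens k m 0 a u [] v) = - ∑ l ∈ Finset.range (u.length + 1),
      tens k m 1 a (u.take l) ((u.drop l).take 1) ((u.drop l).drop 1 ++ v) := by
  have split_path (l : ℕ) (v : Word) :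
      u.take l ++ (u.drop l).take 1 ++ ((u.drop l).drop 1 ++ v) = u ++ [] ++ v := by
    rw [List.append_assoc, ← List.append_assoc ((u.drop l).take 1), List.take_append_drop,
      ← List.append_assoc, List.take_append_drop, List.append_nil]
  by_cases hp : IsPath m a (u ++ [] ++ v)
  · obtain ⟨t, htens, hsrc, hleft, hmid, hright⟩ := exists_tens_eq_single (k := k) ⟨amb_nil, hp⟩
    have hp' : IsPath m a (u ++ [] ++ nf v) := by
      simpa only [hsrc, hleft, hmid, hright, hu.nf_eq] using t.isPath
    rw [htens, gamma_single, hsrc, hleft, hmid, hright, hu.nf_eq, List.append_nil,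
      show (-1 : k) ^ (0 + 1) = -1 by rw [zero_add, pow_one], neg_one_smul]
    congr 1
    refine Finset.sum_congr rfl fun l _ => tens_congr (iff_of_true ?_ ?_) rfl
      (nf_append_congr rfl (nf_nf v))
    · rwa [split_path]
    · rwa [split_path]
  · rw [tens_of_not_isPath hp, map_zero, Finset.sum_eq_zero, neg_zero]
    exact fun l _ => tens_of_not_isPath (by rwa [split_path])

namespace ErrFormula

/-- Of the four summands of `∂_{n+1} δ_{n+2}`, up to tight terms only the rightmost one survives. -/
theorem rho_diff_delta (hE : ErrFormula k m n) {a : ℤ} {x y : Arrow} {r : Word}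
    (ha : Amb (n + 2) (x :: y :: r)) :
    rho k m n (diff k m n (delta k m (n + 1) (tens k m (n + 2) a [] (x :: y :: r) []))) =
      - rho k m n (tens k m n a [x, y] r []) := by
  have diff_eq : diff k m n = delta k m n - err k m n := by
    rw [err]
    abel
  have hy : y ≠ s := (inS_iff.1 (amb_cons_cons.1 ha).1).1
  have ha_left : Amb (n + 1) (x :: (y :: r).take n) := by
    simpa only [List.take_succ_cons] using ha.take
  have rho_err_left := rho_apply_tight
    (hE.err_tens_nil_mem_tightSpan a (x :: (y :: r).take n) ((y :: r).drop n))
  have rho_err_right := rho_apply_tight (hE.err_tens_cons_mem_tightSpan a [x] r [] hy)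
  have rho_tens_nil (w v : Word) : rho k m n (tens k m n a [] w v) = 0 :=
    rho_apply_tight (tens_nil_mem_tightSpan a w v)
  have sign_mul_sign : (-1 : k) ^ (n + 1) * (-1) ^ (n + 1) = 1 := by rw [← mul_pow]; simp
  rw [delta_tens _ _ _ ha, List.take_succ_cons, List.drop_succ_cons, List.append_nil]
  simp only [List.take_succ_cons, List.drop_succ_cons, List.take_zero, List.drop_zero,
    List.nil_append]
  rw [diff_eq, map_add, map_smul, LinearMap.sub_apply, LinearMap.sub_apply,
    delta_tens _ _ _ ha_left, delta_tens _ _ _ ha.tail]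
  simp only [List.take_succ_cons, List.drop_succ_cons, List.take_zero, List.drop_zero,
    List.nil_append, List.append_nil, List.singleton_append, map_add, map_sub, map_smul,
    rho_err_left, rho_err_right, rho_tens_nil]
  rw [pow_succ (-1 : k) (n + 1)]
  simp only [smul_add, smul_smul, mul_neg, neg_mul, mul_one, neg_smul, sign_mul_sign, one_smul,
    sub_zero, zero_add]
  abel

end ErrFormula

theorem tens_eq_of_reduces {a : ℤ} {u u' r v : Word} (hu : Reduces u u')
    (hp : IsPath m a (u ++ r ++ v)) : tens k m n a u r v = tens k m n a u' r v := by
  have hred : Reduces (u ++ r ++ v) (u' ++ r ++ v) := (hu.append_right r).append_right v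
  exact tens_congr (iff_of_true hp (reduces_isPath hred hp)) hu.nf_eq.symm rfl

theorem rho_zero_tens_rule {a : ℤ} {x y : Arrow} {f : Word} (hf : Rule [x, y] f) :
    rho k m 0 (tens k m 0 a f [] []) = - errTerm k m 1 a [] [x, y] [] := by
  have hirr : Irr f := by
    cases hf
    · exact irr_singleton s
    · exact irr_singleton s
    · exact irr_replicate_append_dots (c := p) (by simp) 1 1
    · exact irr_replicate_append_dots (c := q) (by simp) 1 1
  have tens_one_nil (u v : Word) : tens k m 1 a u [] v = 0 := tens_of_not_amb (by simp [Amb])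
  rw [rho_zero_eq_gamma, gamma_zero_tens _ _ hirr, errTerm]
  cases hf <;> simp [Finset.sum_range_succ, tens_one_nil, add_comm]

namespace ErrFormula

theorem rho_succ_tens_rule (hE : ErrFormula k m (n + 1)) {a : ℤ} {x y : Arrow} {f r : Word}
    (ha : Amb (n + 3) (x :: y :: r)) (hf : Rule [x, y] f) :
    rho k m (n + 1) (tens k m (n + 1) a f r []) =
      - errTerm k m (n + 2) a [] (x :: y :: r) [] := by
  obtain ⟨hxy, hyr⟩ := amb_cons_cons.1 ha
  obtain ⟨hy, hx⟩ := inS_iff.1 hxy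
  obtain ⟨c, r, rfl⟩ := List.exists_cons_of_length_eq_add_one hyr.tail.1
  have hc : c ≠ s := (inS_iff.1 (amb_cons_cons.1 hyr).1).1
  rw [errTerm, pow_succ (-1 : k) (n + 2), mul_neg_one, neg_smul, neg_neg]
  split_ifs with hxs
  · obtain rfl : f = [y] ++ [s] := (hxs ▸ hf).eq_of_s
    rw [hE.rho_dot hc, ← List.nil_append [y], hE.rho_arrow hy (irr_singleton y), smul_add,
      add_comm]
    rfl
  · obtain rfl : f = [] ++ [s] := ((hx.resolve_left hxs) ▸ hf).eq_of_opp
    rw [hE.rho_dot hc, rho_apply_tight (tens_nil_mem_tightSpan _ _ _), add_zero]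

theorem neg_rho_tens_pair (hE : ErrFormula k m n) {a : ℤ} {x y : Arrow} {r : Word}
    (ha : Amb (n + 2) (x :: y :: r)) (hp : IsPath m a (x :: y :: r)) :
    - rho k m n (tens k m n a [x, y] r []) = errTerm k m (n + 1) a [] (x :: y :: r) [] := by
  obtain ⟨⟨f, hf⟩, hyr⟩ := amb_cons_cons.1 ha
  have hred : Reduces [x, y] f := by
    simpa only [List.append_nil, List.nil_append] using (Step.mk [] _ _ [] hf).reduces
  have hp' : IsPath m a ([x, y] ++ r ++ []) := by
    simpa only [List.cons_append, List.nil_append, List.append_nil] using hp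
  rw [tens_eq_of_reduces hred hp', neg_eq_iff_eq_neg]
  cases n with
  | zero =>
    obtain rfl : r = [] := List.eq_nil_of_length_eq_zero hyr.tail.1
    exact rho_zero_tens_rule hf
  | succ n => exact hE.rho_succ_tens_rule ha hf

end ErrFormula

theorem sandwich_errTerm (t : Gen m (n + 2)) :
    sandwich k m (n + 1) t (errTerm k m (n + 1) (t.src + shift t.right) [] t.mid []) =
      errTerm k m (n + 1) t.src t.left t.mid t.right := by
  have ha := t.mid_amb
  obtain ⟨x, w, hw⟩ := t.mid_eq_cons
  obtain ⟨y, r, rfl⟩ := List.exists_cons_of_length_eq_add_one (hw ▸ ha).tail.1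
  rw [hw] at ha
  obtain ⟨-, hx⟩ := inS_iff.1 (amb_cons_cons.1 ha).1
  rw [hw, errTerm, errTerm, sandwich_smul]
  congr 1
  split_ifs with hxs
  · subst hxs
    rw [sandwich_add, sandwich_tens, sandwich_tens]
    · simp
    all_goals
      simp only [hw, List.nil_append, List.append_nil, shift_append, shift_s_cons, shift_cons y r,
        shift_nil, add_zero]
  · obtain rfl := hx.resolve_left hxs
    rw [sandwich_tens]
    · simp
    · rw [hw]
      simp only [List.nil_append, shift_append, shift_s_cons, shift_cons (opp y) (_ :: _),
        shift_cons y r, shift_opp, shift_nil, add_zero, neg_add_cancel_left]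

theorem errFormula (n : ℕ) : ErrFormula k m n := by
  induction n with
  | zero => exact errFormula_zero
  | succ n ih =>
    intro t
    have ha := t.mid_amb
    have hp : IsPath m (t.src + shift t.right) t.mid := by
      have := t.isPath
      rw [List.append_assoc, isPath_append, isPath_append] at this
      exact this.1.2
    rw [err_succ_single, ← sandwich_errTerm, core]
    obtain ⟨x, w, hw⟩ := t.mid_eq_cons
    obtain ⟨y, r, rfl⟩ := List.exists_cons_of_length_eq_add_one (hw ▸ ha).tail.1
    rw [hw] at ha hp ⊢
    rw [ih.rho_diff_delta ha, ih.neg_rho_tens_pair ha hp]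

theorem finite_support_rhoSummand (n : ℕ) (t : Gen m n) :
    (Function.support (rhoSummand k m n (diff k m n) t)).Finite := by
  cases n with
  | zero =>
    refine (Set.finite_singleton 0).subset fun i hi => ?_
    by_contra h
    obtain ⟨i, rfl⟩ := Nat.exists_eq_succ_of_ne_zero h
    exact hi (rhoSummand_zero_succ t i)
  | succ n => exact (errFormula (n + 1)).finite_support_rhoSummand t

theorem rho_dot (a : ℤ) (u r v : Word) {c : Arrow} (hc : c ≠ s) :
    rho k m (n + 1) (tens k m (n + 1) a (u ++ [s]) (c :: r) v) =
      (-1 : k) ^ (n + 2) • tens k m (n + 2) a u (s :: c :: r) v +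
        rho k m (n + 1) (tens k m (n + 1) a u (c :: r) (s :: v)) :=
  (errFormula (n + 1)).rho_dot hc

theorem rho_arrow (a : ℤ) {u : Word} (r v : Word) {x : Arrow} (hx : x ≠ s)
    (hu : Irr (u ++ [x])) :
    rho k m (n + 1) (tens k m (n + 1) a (u ++ [x]) r v) =
      (-1 : k) ^ (n + 2) • tens k m (n + 2) a u (x :: r) v :=
  (errFormula (n + 1)).rho_arrow hx hu

theorem rho_ract_tens_replicate_append_dots (a b : ℤ) (y : Word) {c x : Arrow} (A M : ℕ)
    (r v : Word) (hc : c ≠ s) (hx : x ≠ s) :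
    rho k m (n + 1) (ract k m (n + 1) b y
        (tens k m (n + 1) a (List.replicate A x ++ List.replicate M s) (c :: r) v)) =
      ract k m (n + 2) b y (rho k m (n + 1)
        (tens k m (n + 1) a (List.replicate A x ++ List.replicate M s) (c :: r) v)) := by
  induction M generalizing v with
  | zero =>
    rw [List.replicate_zero, List.append_nil]
    cases A with
    | zero =>
      rw [List.replicate_zero,
        rho_apply_tight (ract_mem_tightSpan _ _ (tens_nil_mem_tightSpan _ _ _)),
        rho_apply_tight (tens_nil_mem_tightSpan _ _ _), map_zero]
    | succ A =>
      have hirr : Irr (List.replicate A x ++ [x]) := by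
        rw [← List.replicate_succ']
        exact irr_replicate hx (A + 1)
      rw [List.replicate_succ', rho_arrow _ _ _ hx hirr, map_smul, ract_tens, ract_tens]
      split_ifs
      · rw [rho_arrow _ _ _ hx hirr]
      · rw [map_zero, smul_zero]
  | succ M ih =>
    rw [List.replicate_succ', ← List.append_assoc, rho_dot _ _ _ _ hc, map_add, map_smul, ← ih,
      ract_tens, ract_tens, ract_tens]
    split_ifs
    · rw [rho_dot _ _ _ _ hc, List.cons_append]
    · rw [map_zero, smul_zero, add_zero]

theorem rho_ract (n : ℕ) (b : ℤ) (y : Word) (f : P k m n) :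
    rho k m n (ract k m n b y f) = ract k m (n + 1) b y (rho k m n f) := by
  suffices H : rho k m n ∘ₗ ract k m n b y = ract k m (n + 1) b y ∘ₗ rho k m n from
    LinearMap.congr_fun H f
  refine linearMap_ext_tens fun t => ?_
  simp only [LinearMap.comp_apply]
  cases n with
  | zero =>
    rw [List.eq_nil_of_length_eq_zero t.mid_amb.1, ract_tens, rho_zero_eq_gamma,
      gamma_zero_tens _ _ t.left_irr, map_neg, map_sum]
    simp only [ract_tens]
    split_ifs
    · simp only [gamma_zero_tens _ _ t.left_irr, List.append_assoc]
    · rw [map_zero, Finset.sum_const_zero, neg_zero]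
  | succ n =>
    obtain ⟨c, r, hmid⟩ := t.mid_eq_cons
    rw [hmid]
    by_cases hc : c = s
    · subst hc
      rw [rho_apply_tight (ract_mem_tightSpan _ _ (tens_s_mem_tightSpan _ _ _ _)),
        rho_apply_tight (tens_s_mem_tightSpan _ _ _ _), map_zero]
    · obtain ⟨x, A, M, hx, hleft⟩ := t.left_irr.exists_eq_replicate_append_dots
      rw [hleft, rho_ract_tens_replicate_append_dots _ _ _ _ _ _ _ hc hx]

theorem lact_ract (n : ℕ) (a b : ℤ) (x y : Word) (f : P k m n) :
    lact k m n b x (ract k m n a y f) = ract k m n a y (lact k m n b x f) := by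
  suffices H : lact k m n b x ∘ₗ ract k m n a y = ract k m n a y ∘ₗ lact k m n b x from
    LinearMap.congr_fun H f
  refine linearMap_ext_tens fun t => ?_
  simp only [LinearMap.comp_apply, ract_tens, lact_tens, apply_ite (lact k m n b x),
    apply_ite (ract k m n a y), map_zero]
  by_cases hsrc : a + shift y = t.src
  · have htgt : a + shift (t.left ++ t.mid ++ (t.right ++ y)) =
        t.src + shift (t.left ++ t.mid ++ t.right) := by
      rw [← hsrc]
      simp only [shift_append]
      ring
    simp only [if_pos hsrc, htgt]
  · simp only [if_neg hsrc, ite_self]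

end Differential

/-! ### Sliding dots across ambiguities -/

section SlideTerms

theorem append_singleton_eq_append_cons_dots {u l : Word} {x y : Arrow} {d : ℕ} :
    u ++ [y] = l ++ x :: List.replicate d s ↔
      (d = 0 ∧ u = l ∧ y = x) ∨
        ∃ e, d = e + 1 ∧ y = s ∧ u = l ++ x :: List.replicate e s := by
  cases d with
  | zero => simp
  | succ e =>
    rw [List.replicate_succ', ← List.cons_append, ← List.append_assoc, List.append_singleton_inj]
    simp [and_comm]

variable {k : Type*} [Field k] {m n : ℕ}

/-- The basis elements which occur in `ρ_{n-1}(u ⊗ w ⊗ v)`, for `n ≥ 2`: the last dots of `nf u`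
have been moved across `w`, and the letter `x` before them has become the first one of the
ambiguity. -/
def slideTerms (m n : ℕ) (a : ℤ) (u w v : Word) : Set (Gen m n) :=
  {t | t.src = a ∧ nf (t.left ++ t.mid ++ t.right) = nf (u ++ w ++ v) ∧
    ∃ x d, t.mid = x :: w ∧ nf u = t.left ++ x :: List.replicate d s}

theorem finite_slideTerms (n : ℕ) (a : ℤ) (u w v : Word) : (slideTerms m n a u w v).Finite :=
  (finite_setOf_gen n a _).subset fun _ ht => ⟨ht.1, ht.2.1⟩

theorem slideTerms_nf_left (n : ℕ) (a : ℤ) (u w v : Word) :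
    slideTerms m n a (nf u) w v = slideTerms m n a u w v := by
  simp only [slideTerms, nf_nf, List.append_assoc, nf_nf_append]

theorem slideTerms_nil (n : ℕ) (a : ℤ) (w v : Word) : slideTerms m n a [] w v = ∅ := by
  refine Set.eq_empty_of_forall_notMem ?_
  rintro t ⟨-, -, x, d, -, hd⟩
  simp [irr_nil.nf_eq] at hd

theorem slideTerms_s_cons (n : ℕ) (a : ℤ) (u r v : Word) :
    slideTerms m n a u (s :: r) v = ∅ := by
  refine Set.eq_empty_of_forall_notMem ?_
  rintro t ⟨-, -, x, d, hmid, -⟩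
  have hamb := t.mid_amb.2
  rw [hmid] at hamb
  exact (inS_iff.1 (List.isChain_cons_cons.1 hamb).1).1 rfl

theorem slideTerms_append_singleton (a : ℤ) {u : Word} (w v : Word) {y : Arrow} (hy : y ≠ s)
    (hu : Irr (u ++ [y])) :
    slideTerms m n a (u ++ [y]) w v = {t | t.src = a ∧ t.left = u ∧ t.mid = y :: w ∧
      nf (t.left ++ t.mid ++ t.right) = nf (u ++ y :: w ++ v)} := by
  ext t
  simp only [slideTerms, Set.mem_ofPred_eq, hu.nf_eq, append_singleton_eq_append_cons_dots, hy,
    false_and, and_false, exists_false, or_false, List.append_assoc, List.cons_append,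
    List.nil_append]
  constructor
  · rintro ⟨hsrc, hnf, x, d, hmid, -, rfl, rfl⟩
    exact ⟨hsrc, rfl, hmid, hnf⟩
  · rintro ⟨hsrc, rfl, hmid, hnf⟩
    exact ⟨hsrc, hnf, y, 0, hmid, rfl, rfl, rfl⟩

theorem nf_slide (u w v : Word) : nf (u ++ w ++ s :: v) = nf (u ++ [s] ++ w ++ v) := by
  rw [nf_eq_nf_iff]
  simp only [shift_append, deg_append, shift_cons s v, deg_cons s v]
  constructor <;> ring

theorem slideTerms_append_dot (a : ℤ) {u : Word} (w v : Word) (hu : Irr (u ++ [s])) :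
    slideTerms m n a (u ++ [s]) w v = {t | t.src = a ∧ t.left = u ∧ t.mid = s :: w ∧
      nf (t.left ++ t.mid ++ t.right) = nf (u ++ s :: w ++ v)} ∪ slideTerms m n a u w (s :: v) := by
  have hslide := nf_slide u w v
  simp only [List.append_assoc, List.cons_append, List.nil_append] at hslide
  ext t
  simp only [slideTerms, Set.mem_union, Set.mem_ofPred_eq, hu.nf_eq, hu.of_append_left.nf_eq,
    append_singleton_eq_append_cons_dots, true_and, hslide, List.append_assoc,
    List.cons_append, List.nil_append]
  constructor
  · rintro ⟨hsrc, hnf, x, d, hmid, ⟨-, rfl, rfl⟩ | ⟨e, -, he⟩⟩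
    · exact Or.inl ⟨hsrc, rfl, hmid, hnf⟩
    · exact Or.inr ⟨hsrc, hnf, x, e, hmid, he⟩
  · rintro (⟨hsrc, rfl, hmid, hnf⟩ | ⟨hsrc, hnf, x, e, hmid, he⟩)
    · exact ⟨hsrc, hnf, s, 0, hmid, Or.inl ⟨rfl, rfl, rfl⟩⟩
    · exact ⟨hsrc, hnf, x, e + 1, hmid, Or.inr ⟨e, rfl, he⟩⟩

theorem finsum_mem_single_eq_tens {a : ℤ} {u r v : Word} (hu : Irr u)
    (hp : IsPath m a (u ++ r ++ v)) :
    ∑ᶠ t ∈ {t : Gen m n | t.src = a ∧ t.left = u ∧ t.mid = r ∧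
      nf (t.left ++ t.mid ++ t.right) = nf (u ++ r ++ v)}, Finsupp.single t (1 : k) =
      tens k m n a u r v := by
  by_cases ha : Amb n r
  · obtain ⟨t, htens, hsrc, hleft, hmid, hright⟩ := exists_tens_eq_single (k := k) ⟨ha, hp⟩
    rw [hu.nf_eq] at hleft
    have hnf : nf (t.left ++ t.mid ++ t.right) = nf (u ++ r ++ v) := by
      rw [hleft, hmid, hright, nf_append_nf]
    rw [htens, ← finsum_mem_singleton (f := fun t => Finsupp.single t (1 : k))]
    refine finsum_mem_congr (Set.ext fun t' => ?_) fun _ _ => rfl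
    rw [Set.mem_ofPred_eq, Set.mem_singleton_iff]
    constructor
    · rintro ⟨hsrc', hleft', hmid', hnf'⟩
      exact Gen.ext_of_nf (hsrc'.trans hsrc.symm) (hleft'.trans hleft.symm)
        (hmid'.trans hmid.symm) (hnf'.trans hnf.symm)
    · rintro rfl
      exact ⟨hsrc, hleft, hmid, hnf⟩
  · rw [tens_of_not_amb ha]
    refine finsum_mem_eq_zero_of_forall_eq_zero ?_
    rintro t ⟨-, -, rfl, -⟩
    exact absurd t.mid_amb ha

theorem notMem_slideTerms_left {u : Word} (hu : Irr u) {t : Gen m n} (ht : t.left = u) (a : ℤ)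
    (w v : Word) : t ∉ slideTerms m n a u w v := by
  rintro ⟨-, -, x, d, -, hd⟩
  rw [hu.nf_eq, ht] at hd
  exact List.cons_ne_nil _ _ (List.self_eq_append_right.1 hd)

theorem neg_one_pow_smul_neg_one_pow_smul {M : Type*} [AddCommGroup M] [Module k M] (n : ℕ)
    (x : M) : (-1 : k) ^ n • (-1 : k) ^ n • x = x := by
  rw [smul_smul, ← mul_pow, neg_one_mul, neg_neg, one_pow, one_smul]

theorem smul_rho_tens_of_irr {a : ℤ} {u r v : Word} {c : Arrow} (hc : c ≠ s)
    (hu : Irr u) (hp : IsPath m a (u ++ c :: r ++ v)) :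
    (-1 : k) ^ (n + 2) • rho k m (n + 1) (tens k m (n + 1) a u (c :: r) v) =
      ∑ᶠ t ∈ slideTerms m (n + 2) a u (c :: r) v, Finsupp.single t 1 := by
  induction u using List.reverseRecOn generalizing v with
  | nil =>
    rw [slideTerms_nil, finsum_mem_empty, rho_apply_tight (tens_nil_mem_tightSpan _ _ _), smul_zero]
  | append_singleton u y ih =>
    have hp' : IsPath m a (u ++ y :: c :: r ++ v) := by
      simpa only [List.append_assoc, List.cons_append, List.nil_append] using hp
    by_cases hy : y = s
    · subst hy
      rw [slideTerms_append_dot _ _ _ hu, finsum_mem_union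
          (Set.disjoint_left.2 fun t ht => notMem_slideTerms_left hu.of_append_left ht.2.1 _ _ _)
          ((finite_setOf_gen _ a (u ++ s :: c :: r ++ v)).subset fun t ht => ⟨ht.1, ht.2.2.2⟩)
          (finite_slideTerms _ _ _ _ _),
        finsum_mem_single_eq_tens hu.of_append_left hp', rho_dot _ _ _ _ hc, smul_add,
        neg_one_pow_smul_neg_one_pow_smul, ih hu.of_append_left (isPath_slide_iff.2 hp)]
    · rw [slideTerms_append_singleton _ _ _ hy hu,
        finsum_mem_single_eq_tens hu.of_append_left hp', rho_arrow _ _ _ hy hu,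
        neg_one_pow_smul_neg_one_pow_smul]

theorem smul_rho_tens {a : ℤ} {u w v : Word} (hw : Amb (n + 1) w)
    (hp : IsPath m a (u ++ w ++ v)) :
    (-1 : k) ^ (n + 2) • rho k m (n + 1) (tens k m (n + 1) a u w v) =
      ∑ᶠ t ∈ slideTerms m (n + 2) a u w v, Finsupp.single t 1 := by
  obtain ⟨c, r, rfl⟩ := List.exists_cons_of_length_eq_add_one hw.1
  by_cases hc : c = s
  · subst hc
    rw [slideTerms_s_cons, finsum_mem_empty, rho_apply_tight (tens_s_mem_tightSpan _ _ _ _),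
      smul_zero]
  · have hred : Reduces (u ++ c :: r ++ v) (nf u ++ c :: r ++ v) :=
      ((reduces_nf u).append_right _).append_right v
    have hp' := reduces_isPath hred hp
    rw [tens_eq_of_reduces (reduces_nf u) hp, smul_rho_tens_of_irr hc (irr_nf u) hp',
      slideTerms_nf_left]

end SlideTerms

/-! ### Terms for one more path -/

section NextTerms

variable {m n : ℕ}

/-- The terms of the splittings for `y_n ⋯ y_1` which `ρ` produces from `y_n · t`, where `t` is a
term for `y_{n-1} ⋯ y_1`. -/
def nextTerms (y : Word) (t : Gen m n) : Set (Gen m (n + 1)) :=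
  slideTerms m (n + 1) t.src (y ++ t.left) t.mid t.right

theorem exists_nf_eq_of_crosses {j i : ℤ} {A z y' y'' w : Word} {c : Arrow}
    (hA : Irr (A ++ opp c :: z)) (hy : Irr (y' ++ c :: y''))
    (hc : Crosses j (i + shift (y'' ++ w)) [c])
    (hz : Crosses j (i + shift (z ++ (y' ++ c :: y'' ++ w))) [opp c]) :
    ∃ d, nf (A ++ opp c :: z ++ y') = A ++ opp c :: List.replicate d s := by
  obtain ⟨-, hshift⟩ := eq_opp_of_crosses_of_crosses hy hA hc hz
  obtain ⟨d, hd⟩ := reduces_dots_of_shift_eq_zero hshift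
  have hirr : Irr (A ++ [opp c] ++ List.replicate d s) :=
    (hA.of_infix ⟨[], z, by simp⟩ : Irr (A ++ [opp c])).append_dots d
  refine ⟨d, ?_⟩
  have hred := hd.append_left (A ++ [opp c])
  simpa only [List.append_assoc, List.cons_append, List.nil_append] using
    hred.nf_eq.symm.trans hirr.nf_eq

theorem exists_crosses_of_nf_eq {j i : ℤ} {y A y' y'' w : Word} {c : Arrow} {d : ℕ}
    (hyi : Irr y) (hy : Irr (y' ++ c :: y'')) (hc : Crosses j (i + shift (y'' ++ w)) [c])
    (hnf : nf (y ++ y') = A ++ opp c :: List.replicate d s) :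
    ∃ z, y = A ++ opp c :: z ∧ Crosses j (i + shift (z ++ (y' ++ c :: y'' ++ w))) [opp c] := by
  have hcs := hc.ne_s
  obtain ⟨l, rfl⟩ := Irr.left_eq_replicate (opp_ne_s hcs) (hnf ▸ irr_nf (y ++ y'))
  obtain ⟨l', rfl⟩ := hy.left_eq_replicate hcs
  obtain ⟨x, b, e, hx, rfl⟩ := hyi.exists_eq_replicate_append_dots
  have hshift := shift_nf (List.replicate b x ++ List.replicate e s ++ List.replicate l' c)
  rw [hnf] at hshift
  simp only [shift_append, shift_cons (opp c) (List.replicate _ _), shift_replicate,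
    shift_s, shift_opp, mul_zero, add_zero] at hshift
  have hxb : List.replicate b x = List.replicate (l + 1 + l') (opp c) := by
    cases c <;> cases x <;> simp [opp] at hshift hcs hx ⊢ <;> omega
  refine ⟨List.replicate l' (opp c) ++ List.replicate e s, ?_, ?_⟩
  · rw [hxb, ← List.replicate_append_replicate, List.replicate_succ']
    simp
  · have hz : shift (List.replicate l' (opp c) ++ List.replicate e s ++
        (List.replicate l' c ++ c :: y'' ++ w)) = shift [c] + shift (y'' ++ w) := by
      simp only [shift_append, shift_cons c y'', shift_replicate, shift_s, shift_opp]
      ring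
    rwa [hz, ← shift_cons, crosses_opp_cons_iff]

variable {k : Type*} [Field k]

theorem exists_mem_nextTerms {i : ℤ} {y y₁ : Word} {ys : List Word}
    (hn : ys.length = n) (hys : ∀ x ∈ y :: y₁ :: ys, Irr x)
    (hp : IsPath m i (y :: y₁ :: ys).flatten) {t' : Gen m (n + 2)}
    (ht' : t' ∈ splitTerms k m (n + 2) i (y :: y₁ :: ys).flatten) :
    ∃ t ∈ splitTerms k m (n + 1) i (y₁ :: ys).flatten, t' ∈ nextTerms y t := by
  rw [splitTerms_eq_strandTerms (by rw [List.length_cons, hn]) hys hp] at ht'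
  obtain ⟨hsrc', hnf', j, -, -, hall, y', c, y'', rest, heq, hc, ht'⟩ := ht'
  obtain ⟨rfl, rfl⟩ := List.cons.inj heq
  rw [List.forall_mem_cons] at hys
  have hys₁ := List.forall_mem_cons.1 hys.2
  rw [List.flatten_cons, isPath_append] at hp
  obtain ⟨v, hv⟩ := (allCross_cons.1 hall).2.reduces hys₁.2 hys₁.1 hc
  rw [hn] at hv
  obtain ⟨t, -, hsrc, hleft, hmid, hright⟩ := exists_tens_eq_single (k := k)
    ⟨amb_zigzag hc.ne_s (n + 1), reduces_isPath hv hp.1⟩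
  rw [hys₁.1.of_append_left.nf_eq] at hleft
  have hnf : nf (t.left ++ t.mid ++ t.right) = nf (y' ++ c :: y'' ++ ys.flatten) := by
    rw [hleft, hmid, hright, nf_append_nf, hv.nf_eq]
  refine ⟨t, (mem_splitTerms_iff_of_mid_eq_zigzag hn hys.2 hp.1 hc.ne_s hmid).2
    ⟨hsrc, hnf, j, hall, y'', by rw [hleft], hc⟩, hsrc'.trans hsrc.symm, ?_, ?_⟩
  · rw [hnf']
    simpa only [List.flatten_cons, List.append_assoc] using
      nf_append_congr (u := y) rfl hnf.symm
  · rw [hleft, hmid]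
    rcases ht' with ⟨hmid', d, hd⟩ | ⟨hmid', z, rfl, hz⟩
    · exact ⟨s, d, hmid', hd⟩
    · obtain ⟨d, hd⟩ := exists_nf_eq_of_crosses hys.1 hys₁.1 hc hz
      refine ⟨opp c, d, ?_, hd⟩
      rw [hmid', zigzag, opp_opp]

theorem mem_splitTerms_of_mem_nextTerms {i : ℤ} {y y₁ : Word} {ys : List Word}
    (hn : ys.length = n) (hys : ∀ x ∈ y :: y₁ :: ys, Irr x)
    (hp : IsPath m i (y :: y₁ :: ys).flatten) {t : Gen m (n + 1)} {t' : Gen m (n + 2)}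
    (ht : t ∈ splitTerms k m (n + 1) i (y₁ :: ys).flatten) (ht' : t' ∈ nextTerms y t) :
    t' ∈ splitTerms k m (n + 2) i (y :: y₁ :: ys).flatten := by
  rw [splitTerms_eq_strandTerms (by rw [List.length_cons, hn]) hys hp]
  rw [List.forall_mem_cons] at hys
  rw [List.flatten_cons, isPath_append] at hp
  obtain ⟨hsrc', hnf', x, d, hmid', hd⟩ := ht'
  obtain ⟨c, r, hmid⟩ := t.mid_eq_cons
  rw [hmid] at hmid'
  obtain ⟨hc, hx⟩ := inS_iff.1 (amb_cons_cons.1 (hmid' ▸ t'.mid_amb)).1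
  have hzigzag : c :: r = zigzag c (n + 1) :=
    (amb_cons_iff_eq_zigzag hc).1 (hmid ▸ t.mid_amb)
  obtain ⟨hsrc, hnf, j, hall, y'', rfl, hcross⟩ :=
    (mem_splitTerms_iff_of_mid_eq_zigzag hn hys.2 hp.1 hc (hmid.trans hzigzag)).1 ht
  obtain ⟨hj, hjm⟩ := hcross.strand_bounds (by
    simpa only [List.flatten_cons, List.append_assoc, List.cons_append] using hp.1)
  refine ⟨hsrc'.trans hsrc, ?_, j, hj, hjm, hall, t.left, c, y'', ys, rfl, hcross, ?_⟩
  · rw [hnf']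
    simpa only [List.append_assoc] using nf_append_congr (u := y) rfl hnf
  · rw [hzigzag] at hmid'
    rcases hx with rfl | rfl
    · exact Or.inl ⟨hmid', d, hd⟩
    · obtain ⟨z, hz⟩ := exists_crosses_of_nf_eq hys.1 (List.forall_mem_cons.1 hys.2).1 hcross hd
      refine Or.inr ⟨?_, z, hz⟩
      rw [hmid', zigzag, zigzag, zigzag, opp_opp]

theorem splitTerms_cons_eq_biUnion {i : ℤ} {y : Word} {ys : List Word} (hn : ys.length = n + 1)
    (hys : ∀ x ∈ y :: ys, Irr x) (hp : IsPath m i (y :: ys).flatten) :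
    splitTerms k m (n + 2) i (y :: ys).flatten =
      ⋃ t ∈ splitTerms k m (n + 1) i ys.flatten, nextTerms y t := by
  obtain ⟨y₁, ys, rfl⟩ := List.exists_cons_of_length_eq_add_one hn
  rw [List.length_cons, Nat.add_right_cancel_iff] at hn
  ext t'
  simp only [Set.mem_iUnion, exists_prop]
  exact ⟨exists_mem_nextTerms hn hys hp, fun ⟨_, ht, ht'⟩ =>
    mem_splitTerms_of_mem_nextTerms hn hys hp ht ht'⟩

theorem mid_eq_and_shift_eq_of_mem_nextTerms {y : Word} {t₁ t₂ : Gen m n} {t : Gen m (n + 1)}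
    (h₁ : t ∈ nextTerms y t₁) (h₂ : t ∈ nextTerms y t₂) :
    t₁.mid = t₂.mid ∧ shift t₁.left = shift t₂.left := by
  obtain ⟨-, -, x, d₁, hmid₁, hd₁⟩ := h₁
  obtain ⟨-, -, x', d₂, hmid₂, hd₂⟩ := h₂
  obtain ⟨rfl, hmid⟩ := List.cons.inj (hmid₁.symm.trans hmid₂)
  have hshift : shift (y ++ t₁.left) = shift (y ++ t₂.left) := by
    rw [← shift_nf, ← shift_nf (y ++ t₂.left), hd₁, hd₂]
    simp only [shift_append, shift_cons x (List.replicate _ _), shift_replicate, shift_s, mul_zero]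
  rw [shift_append, shift_append] at hshift
  exact ⟨hmid, add_left_cancel hshift⟩

theorem pairwiseDisjoint_nextTerms {i : ℤ} {y : Word} {ys : List Word} (hn : ys.length = n + 1)
    (hys : ∀ x ∈ ys, Irr x) (hp : IsPath m i ys.flatten) :
    (splitTerms k m (n + 1) i ys.flatten).PairwiseDisjoint (nextTerms y) := by
  obtain ⟨y₁, ys, rfl⟩ := List.exists_cons_of_length_eq_add_one hn
  rw [List.length_cons, Nat.add_right_cancel_iff] at hn
  intro t₁ ht₁ t₂ ht₂ hne
  refine Set.disjoint_left.2 fun t h₁ h₂ => hne ?_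
  obtain ⟨hmid, hshift⟩ := mid_eq_and_shift_eq_of_mem_nextTerms h₁ h₂
  obtain ⟨-, -, x, -, hx, -⟩ := h₁
  obtain ⟨c, r, hc⟩ := t₁.mid_eq_cons
  rw [hc] at hx
  have hcs : c ≠ s := (inS_iff.1 (amb_cons_cons.1 (hx ▸ t.mid_amb)).1).1
  have hzigzag : t₁.mid = zigzag c (n + 1) :=
    hc.trans ((amb_cons_iff_eq_zigzag hcs).1 (hc ▸ t₁.mid_amb))
  obtain ⟨hsrc₁, hnf₁, -, -, z₁, hz₁, -⟩ :=
    (mem_splitTerms_iff_of_mid_eq_zigzag hn hys hp hcs hzigzag).1 ht₁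
  obtain ⟨hsrc₂, hnf₂, -, -, z₂, hz₂, -⟩ :=
    (mem_splitTerms_iff_of_mid_eq_zigzag hn hys hp hcs (hmid ▸ hzigzag)).1 ht₂
  have hy₁ := (List.forall_mem_cons.1 hys).1
  obtain ⟨l₁, hl₁⟩ := Irr.left_eq_replicate hcs (hz₁ ▸ hy₁)
  obtain ⟨l₂, hl₂⟩ := Irr.left_eq_replicate hcs (hz₂ ▸ hy₁)
  refine Gen.ext_of_nf (hsrc₁.trans hsrc₂.symm) ?_ hmid (hnf₁.trans hnf₂.symm)
  rw [hl₁, hl₂, shift_replicate, shift_replicate] at hshift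
  have hl : (l₁ : ℤ) = l₂ := by
    rcases shift_eq_one_or_neg_one hcs with h | h <;> rw [h] at hshift <;> omega
  rw [hl₁, hl₂, Nat.cast_injective hl]

end NextTerms

/-! ### The comparison map -/

section SplitSum

variable {k : Type*} [Field k] {m n : ℕ} {i : ℤ}

variable (k m n i) in
/-- The sum of the distinct terms of the `split_n(w)` with `w ⪯ y_n ⋯ y_1`. -/
noncomputable def splitSum (ys : List Word) : P k m n :=
  ∑ᶠ t ∈ splitTerms k m n i ys.flatten, Finsupp.single t (1 : k)

theorem map_splitSum {M : Type*} [AddCommGroup M] [Module k M] (F : P k m n →ₗ[k] M)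
    (ys : List Word) : F (splitSum k m n i ys) =
      ∑ᶠ t ∈ splitTerms k m n i ys.flatten, F (Finsupp.single t 1) :=
  AddMonoidHom.map_finsum_mem _ F.toAddMonoidHom (finite_splitTerms n i _)

theorem tgt_of_mem_splitTerms {w : Word} {t : Gen m n} (ht : t ∈ splitTerms k m n i w) :
    t.tgt = i + shift w := by
  rw [Gen.tgt, (mem_splitTerms.1 ht).1, (nf_eq_nf_iff.1 (nf_eq_of_mem_splitTerms ht)).1]

theorem ract_lact_splitSum_eq_zero {a b : ℤ} {x z : Word} {ys : List Word}
    (h : ¬ (b = i + shift ys.flatten ∧ a + shift z = i)) :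
    ract k m n a z (lact k m n b x (splitSum k m n i ys)) = 0 := by
  rw [← LinearMap.comp_apply, map_splitSum]
  refine finsum_mem_eq_zero_of_forall_eq_zero fun t ht => ?_
  rw [LinearMap.comp_apply, lact, Finsupp.linearCombination_single, one_smul,
    tgt_of_mem_splitTerms ht, (mem_splitTerms.1 ht).1]
  split_ifs with hb
  · rw [ract_tens, if_neg fun ha => h ⟨hb, ha⟩]
  · exact map_zero _

theorem splitSum_singleton_of_irr {w : Word} (hw : Irr w) :
    splitSum k m n i [w] = split k m n i w := by
  classical
  have hterms : splitTerms k m n i [w].flatten = ↑(split k m n i w).support := by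
    rw [List.flatten_singleton]
    ext t
    exact ⟨fun ⟨_, hred, ht⟩ => hred.eq_of_irr hw ▸ ht, fun ht => ⟨w, Reduces.refl w, ht⟩⟩
  rw [splitSum, hterms, finsum_mem_coe_finset]
  conv_rhs => rw [← Finsupp.sum_single (split k m n i w)]
  refine Finset.sum_congr rfl fun t ht => ?_
  rw [Finsupp.mem_support_iff, split_apply] at ht
  rw [split_apply, if_pos (ite_ne_right_iff.1 ht).1]

theorem splitSum_nil (i : ℤ) : splitSum k m 0 i [] = tens k m 0 i [] [] [] := by
  have hsplit : split k m 0 i [] = tens k m 0 i [] [] [] := by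
    simp [split]
  rw [← hsplit, ← splitSum_singleton_of_irr irr_nil]
  rfl

theorem splitSum_cons {y : Word} {ys : List Word} (hn : ys.length = n)
    (hys : ∀ x ∈ y :: ys, Irr x) (hp : IsPath m i (y :: ys).flatten) :
    splitSum k m (n + 1) i (y :: ys) = (-1 : k) ^ (n + 1) •
      rho k m n (lact k m n (i + shift ys.flatten) y (splitSum k m n i ys)) := by
  rw [List.forall_mem_cons] at hys
  rcases n with - | n
  · obtain rfl := List.eq_nil_of_length_eq_zero hn
    rw [splitSum_singleton_of_irr hys.1, splitSum_nil, lact_tens, if_pos (by simp),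
      List.append_nil, rho_zero_eq_gamma, gamma_zero_tens _ _ hys.1]
    simp [split]
  · have hpath := (isPath_append _ _ _ _).1 hp
    rw [splitSum, splitTerms_cons_eq_biUnion hn (List.forall_mem_cons.2 hys) hp,
      finsum_mem_biUnion (pairwiseDisjoint_nextTerms hn hys.2 hpath.1) (finite_splitTerms _ _ _)
        (fun t _ => finite_slideTerms _ _ _ _ _), ← LinearMap.comp_apply, ← LinearMap.smul_apply,
      map_splitSum]
    refine finsum_mem_congr rfl fun t ht => ?_
    have htgt := tgt_of_mem_splitTerms ht
    rw [Gen.tgt] at htgt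
    rw [LinearMap.smul_apply, LinearMap.comp_apply, single_eq_tens, lact_tens,
      if_pos htgt.symm, smul_rho_tens t.mid_amb]
    · rfl
    · rw [List.append_assoc y, List.append_assoc y, isPath_append]
      exact ⟨t.isPath, htgt ▸ hpath.2⟩

end SplitSum

section Comparison

variable {k : Type*} [Field k] {m n : ℕ} {a : ℤ} {x z : Word} {ys : List Word}

theorem map_nf_of_irr (hys : ∀ y ∈ ys, Irr y) : ys.map nf = ys :=
  (List.map_congr_left fun y hy => (hys y hy).nf_eq).trans (List.map_id ys)

theorem barTens_of_irr (hx : Irr x) (hn : ys.length = n) (hys : ∀ y ∈ ys, Irr y ∧ y ≠ [])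
    (hz : Irr z) (hp : IsPath m a (x ++ ys.flatten ++ z)) :
    barTens k m n a x ys z = Finsupp.single ⟨a, x, ys, z, hx, hn, hys, hz, hp⟩ 1 := by
  have hne : ∀ y ∈ ys, nf y ≠ [] := fun y hy => (hys y hy).1.nf_eq.symm ▸ (hys y hy).2
  rw [barTens, dif_pos ⟨hn, hne, hp⟩]
  congr 1
  exact BarGen.ext rfl hx.nf_eq (map_nf_of_irr fun y hy => (hys y hy).1) hz.nf_eq

theorem rhoNegOne_mem_tightSpan (f : A k m) : rhoNegOne k m f ∈ tightSpan k m 0 := by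
  rw [rhoNegOne, Finsupp.linearCombination_apply]
  exact Submodule.sum_mem _ fun x _ =>
    Submodule.smul_mem _ _ (tens_nil_mem_tightSpan _ _ _)

theorem G_barTens_nil_mem_tightSpan (a : ℤ) (ys : List Word) (z : Word) :
    G k m n (barTens k m n a [] ys z) ∈ tightSpan k m n := by
  rw [barTens]
  split_ifs
  · cases n <;> simp only [G, Finsupp.linearCombination_single, one_smul, irr_nil.nf_eq]
    · exact lact_nil_mem_tightSpan _ (rhoNegOne_mem_tightSpan _)
    · exact lact_nil_mem_tightSpan _ (rho_mem_tightSpan _)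
  · rw [map_zero]
    exact zero_mem _

theorem G_zero_barTens (hx : Irr x) (hz : Irr z) (hp : IsPath m a (x ++ z)) :
    G k m 0 (barTens k m 0 a x [] z) = lact k m 0 (a + shift z) x (tens k m 0 a [] [] z) := by
  have hlen : ([] : List Word).length = 0 := rfl
  have hnil : ∀ y ∈ ([] : List Word), Irr y ∧ y ≠ [] := by simp
  have hpz := ((isPath_append _ _ _ _).1 hp).1
  rw [barTens_of_irr hx hlen hnil hz (by simpa using hp), G, Finsupp.linearCombination_single,
    one_smul, barTens_of_irr irr_nil hlen hnil hz (by simpa using hpz), barDiffZero,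
    Finsupp.linearCombination_single, one_smul]
  simp only [List.flatten_nil, List.nil_append, proj, dif_pos hpz, rhoNegOne,
    Finsupp.linearCombination_single, one_smul, hz.nf_eq]

theorem G_succ_barTens (hx : Irr x) (hn : ys.length = n + 1) (hys : ∀ y ∈ ys, Irr y ∧ y ≠ [])
    (hz : Irr z) (hp : IsPath m a (x ++ ys.flatten ++ z)) :
    G k m (n + 1) (barTens k m (n + 1) a x ys z) = lact k m (n + 1) (a + shift (ys.flatten ++ z)) x
      (rho k m n (G k m n (barDiff k m n (barTens k m (n + 1) a [] ys z)))) := by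
  rw [barTens_of_irr hx hn hys hz hp, G, Finsupp.linearCombination_single, one_smul]

/-- All other summands of the bar differential keep the left factor `1`, which `G` turns into
tight terms. -/
theorem rho_G_barDiff_barTens_nil {y : Word} (hn : ys.length = n)
    (hys : ∀ x ∈ y :: ys, Irr x ∧ x ≠ []) (hz : Irr z) (hp : IsPath m a ((y :: ys).flatten ++ z)) :
    rho k m n (G k m n (barDiff k m n (barTens k m (n + 1) a [] (y :: ys) z))) =
      (-1 : k) ^ (n + 1) • rho k m n (G k m n (barTens k m n a y ys z)) := by
  have rho_G_nil (ys : List Word) (z : Word) :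
      rho k m n (G k m n (barTens k m n a [] ys z)) = 0 :=
    rho_apply_tight (G_barTens_nil_mem_tightSpan _ _ _)
  rw [barTens_of_irr irr_nil (by rw [List.length_cons, hn]) hys hz hp, barDiff,
    Finsupp.linearCombination_single, one_smul]
  simp only [map_add, map_sum, map_smul, rho_G_nil, smul_zero, Finset.sum_const_zero, zero_add,
    List.nil_append, List.headD_cons, List.tail_cons]

theorem G_barTens (hx : Irr x) (hn : ys.length = n) (hys : ∀ y ∈ ys, Irr y ∧ y ≠ [])
    (hz : Irr z) (hp : IsPath m a (x ++ ys.flatten ++ z)) :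
    G k m n (barTens k m n a x ys z) = lact k m n (a + shift (ys.flatten ++ z)) x
      (ract k m n a z (splitSum k m n (a + shift z) ys)) := by
  induction n generalizing x ys with
  | zero =>
    obtain rfl := List.eq_nil_of_length_eq_zero hn
    rw [List.flatten_nil, List.append_nil] at hp
    rw [G_zero_barTens hx hz hp, splitSum_nil, ract_tens, if_pos rfl, List.flatten_nil,
      List.nil_append]
  | succ n ih =>
    obtain ⟨y, ys, rfl⟩ := List.exists_cons_of_length_eq_add_one hn
    have hlen : ys.length = n := Nat.succ_injective hn
    have hpath : IsPath m a ((y :: ys).flatten ++ z) := by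
      rw [List.append_assoc, isPath_append] at hp
      exact hp.1
    have hflat : a + shift (ys.flatten ++ z) = a + shift z + shift ys.flatten := by
      rw [shift_append]
      ring
    obtain ⟨⟨hy, -⟩, hys'⟩ := List.forall_mem_cons.1 hys
    rw [G_succ_barTens hx hn hys hz hp, rho_G_barDiff_barTens_nil hlen hys hz hpath,
      ih hy hlen hys' hpath, lact_ract, rho_ract, hflat, ← map_smul, ← splitSum_cons hlen
        (fun w hw => (hys w hw).1) ((isPath_append _ _ _ _).1 hpath).2]

theorem G_bar {i : ℤ} (hn : ys.length = n) (hys : ∀ y ∈ ys, Irr y ∧ y ≠ [])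
    (hp : IsPath m i ys.flatten) (a b : A k m) :
    G k m n (bar n a i ys b) = rmul (lmul a (splitSum k m n i ys)) b := by
  have G_basis (x z : IrrPath m) :
      G k m n (if x.src = i + shift ys.flatten ∧ z.src + shift z.word = i then
        barTens k m n z.src x.word ys z.word else 0) =
      ract k m n z.src z.word (lact k m n x.src x.word (splitSum k m n i ys)) := by
    split_ifs with h
    · obtain ⟨hsrc, rfl⟩ := h
      have hpath : IsPath m z.src (x.word ++ ys.flatten ++ z.word) := by
        rw [isPath_append, isPath_append, ← hsrc]
        exact ⟨z.isPath, hp, x.isPath⟩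
      rw [G_barTens x.irr hn hys z.irr hpath, lact_ract, hsrc, shift_append,
        add_comm (shift ys.flatten), add_assoc]
    · rw [map_zero, ract_lact_splitSum_eq_zero h]
  simp only [bar, rmul, lmul, Finsupp.sum, map_sum, map_smul, G_basis, Finset.smul_sum, smul_smul]
  rw [Finset.sum_comm]
  simp only [mul_comm]

end Comparison

end KLRW

theorem mainTheorem10 {k : Type*} [Field k] (m : ℕ) :
    (∀ (n : ℕ) (t : KLRW.Gen m n),
      (Function.support (KLRW.rhoSummand k m n (KLRW.diff k m n) t)).Finite) ∧
    ∀ (n : ℕ) (i : ℤ) (ys : List KLRW.Word), ys.length = n →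
      (∀ y ∈ ys, KLRW.Irr y ∧ y ≠ []) → KLRW.IsPath m i ys.flatten →
      (KLRW.splitTerms k m n i ys.flatten).Finite ∧
      (∀ a b : KLRW.A k m,
        KLRW.G k m n (KLRW.bar n a i ys b) =
          KLRW.rmul (KLRW.lmul a
            (∑ᶠ t ∈ KLRW.splitTerms k m n i ys.flatten, Finsupp.single t (1 : k))) b) ∧
      (∀ (yn : KLRW.Word) (ys' : List KLRW.Word), ys = yn :: ys' → ys' ≠ [] →
        KLRW.splitTerms k m n i ys.flatten = KLRW.strandTerms m n i yn ys') := by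
  refine ⟨fun n t => KLRW.finite_support_rhoSummand n t, fun n i ys hn hys hp =>
    ⟨KLRW.finite_splitTerms n i _, fun a b => KLRW.G_bar hn hys hp a b, ?_⟩⟩
  rintro yn ys' rfl hne
  rcases ys' with _ | ⟨y, ys⟩
  · exact absurd rfl hne
  · subst hn
    exact KLRW.splitTerms_eq_strandTerms rfl (fun x hx => (hys x hx).1) hp
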